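/- **Setting.** A network consists of a finite node set $\mathcal V$, $|\mathcal V|\ge 2$, and a set $\mathcal E$ of directed links $(u,v)$, $u\neq v$. A hypercycle has $\Gamma\ge 1$ time slots, read modulo $\Gamma$. A time-expanded cyclic graph (TECG) has vertices $u_t$ ($u\in\mathcal V$, $t$ a slot), all storage edges $(u_t,u_{t+1})$, and a communication edge $(u_t,v_{t+1})$ for each link $(u,v)\in\mathcal E$ and each slot $t$ in which that link is available; otherwise the slot is occupied on the link. A flow consists of a source $s$, a destination $d$, an arrival slot $1\le\gamma\le\Gamma$, a cycle length $\lambda\ge1$ with $\lambda\mid\Gamma$, and a maximum delay $\rho\ge 1$. Its $i$-th packet ($1\le i\le\Gamma/\lambda$) arrives in slot $\gamma_i=\gamma+(i-1)\lambda$, its deadline is the slot $\bar\gamma_i=\gamma_i+\rho-1$, and its lifespan is the set of slots $\gamma_i,\dots,\bar\gamma_i$. With respect to the current TECG, the weight for packet $i$ of a communication edge of the link $(u,v)$ is $\alpha_{u,v}+\beta_{u,v}$, where $\alpha_{u,v}$ is the number of occupied slots of $(u,v)$ divided by $\Gamma$, and $\beta_{u,v}$ is the number of occupied slots of $(u,v)$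 in the lifespan divided by $\rho$ if $\rho<\Gamma$, and $\beta_{u,v}=\alpha_{u,v}$ if $\rho\ge\Gamma$. Storage edges have weight $0$. **Algorithm HFS-LLF.** For $i=1,\dots,\Gamma/\lambda$: compute the weights for packet $i$; set aside all edges of slot $\bar\gamma_i+1$; if there is a path from $s_{\gamma_i}$ to $d_{\bar\gamma_i+1}$ in the remaining graph, find a path of least total weight, record it, remove its communication edges in the lifespan from the TECG, and restore the edges set aside. If there is no such path, restore the edges set aside and the edges of all recorded paths, and terminate with empty output. **Model.** A word RAM with words of $O(\log(|\mathcal V|+|\mathcal E|+\Gamma+\rho))$ bits, whose unit-cost operations are memory access, addition, truncated subtraction, multiplication, integer division, remainder and comparison. The TECG is stored as the list of links, a random-access availability bit for each link and slot, and, as a label of each link, the number of its occupied slots. **Lemma (worst-case complexity of HFS-LLF).** HFS-LLF runs in worst-case time $$O\Big(\frac{\Gamma}{\lambda}\,\rho\,\big(|\mathcal E|+|\mathcal V|\log|\mathcal V|\big)\Big).$$ That is, there are a single program and absolute constants $C$, $k$ such that for all inputs as above, with words holding the numbers up to $(|\mathcal V|+|\mathcal E|+\Gamma+\rho)^k$,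 the program halts after at most $C\,\frac{\Gamma}{\lambda}\rho(|\mathcal E|+|\mathcal V|\log|\mathcal V|)$ steps, carries out a run of HFS-LLF in the sense that it ends with the list of schedule paths and the updated TECG (in the same representation, labels included) produced by some run, and this run makes at most $\Gamma/\lambda$ shortest-path computations, and exactly $\Gamma/\lambda$, with $\Gamma/\lambda$ output paths, unless it rejects the flow. Moreover, each shortest-path computation is confined to $\rho$ time slots: each path from $s_{\gamma_i}$ that it may choose has at most $\rho$ edges, all in slots of the lifespan of packet $i$. -/

import Mathlib

namespace HFS

/-! ## A word RAM, presented as a structured program with a step count -/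

/-- A memory: registers, and finitely many (per program) random-access arrays of words. -/
structure Memory where
  reg : ℕ → ℕ
  arr : ℕ → ℕ → ℕ

/-- Register `x` receives the word `w`. -/
def Memory.setReg (σ : Memory) (x w : ℕ) : Memory :=
  { σ with reg := Function.update σ.reg x w }

/-- Cell `i` of array `a` receives the word `w`. -/
def Memory.setCell (σ : Memory) (a i w : ℕ) : Memory :=
  { σ with arr := Function.update σ.arr a (Function.update (σ.arr a) i w) }

/-- Expressions over natural-number words.  Subtraction is truncated, `x / 0 = 0`, and the
comparisons return `1` (true) or `0` (false). -/
inductive Expr where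
  | const (c : ℕ)
  | reg (x : ℕ)
  | cell (a : ℕ) (i : Expr)
  | add (e f : Expr)
  | sub (e f : Expr)
  | mul (e f : Expr)
  | div (e f : Expr)
  | mod (e f : Expr)
  | lt (e f : Expr)
  | eq (e f : Expr)

/-- The value of an expression. -/
def Expr.eval (σ : Memory) : Expr → ℕ
  | .const c => c
  | .reg x => σ.reg x
  | .cell a i => σ.arr a (i.eval σ)
  | .add e f => e.eval σ + f.eval σ
  | .sub e f => e.eval σ - f.eval σ
  | .mul e f => e.eval σ * f.eval σ
  | .div e f => e.eval σ / f.eval σ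
  | .mod e f => e.eval σ % f.eval σ
  | .lt e f => if e.eval σ < f.eval σ then 1 else 0
  | .eq e f => if e.eval σ = f.eval σ then 1 else 0

/-- The number of elementary operations needed to evaluate an expression. -/
def Expr.cost : Expr → ℕ
  | .const _ => 1
  | .reg _ => 1
  | .cell _ i => i.cost + 1
  | .add e f => e.cost + f.cost + 1
  | .sub e f => e.cost + f.cost + 1
  | .mul e f => e.cost + f.cost + 1
  | .div e f => e.cost + f.cost + 1
  | .mod e f => e.cost + f.cost + 1
  | .lt e f => e.cost + f.cost + 1
  | .eq e f => e.cost + f.cost + 1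

/-- Every value that arises in the evaluation of the expression is a word, i.e. at most `W`. -/
def Expr.Fits (W : ℕ) (σ : Memory) : Expr → Prop
  | .const c => c ≤ W
  | .reg x => σ.reg x ≤ W
  | .cell a i => i.Fits W σ ∧ σ.arr a (i.eval σ) ≤ W
  | .add e f => e.Fits W σ ∧ f.Fits W σ ∧ e.eval σ + f.eval σ ≤ W
  | .sub e f => e.Fits W σ ∧ f.Fits W σ
  | .mul e f => e.Fits W σ ∧ f.Fits W σ ∧ e.eval σ * f.eval σ ≤ W
  | .div e f => e.Fits W σ ∧ f.Fits W σ
  | .mod e f => e.Fits W σ ∧ f.Fits W σ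
  | .lt e f => e.Fits W σ ∧ f.Fits W σ ∧ 1 ≤ W
  | .eq e f => e.Fits W σ ∧ f.Fits W σ ∧ 1 ≤ W

/-- Programs. -/
inductive Program where
  | skip
  | assign (x : ℕ) (e : Expr)
  | store (a : ℕ) (i e : Expr)
  | seq (c₁ c₂ : Program)
  | ite (b : Expr) (c₁ c₂ : Program)
  | loop (b : Expr) (c : Program)

/-- `Exec W c σ σ' T`: on a machine whose words hold the numbers `0, …, W`, the program `c`
started in `σ` halts in `σ'` after exactly `T` steps.  An overflow leaves the machine stuck.
`loop b c` is the loop "while `b ≠ 0` do `c`". -/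
inductive Exec (W : ℕ) : Program → Memory → Memory → ℕ → Prop where
  | skip (σ : Memory) : Exec W .skip σ σ 1
  | assign (σ : Memory) (x : ℕ) (e : Expr) (h : e.Fits W σ) :
      Exec W (.assign x e) σ (σ.setReg x (e.eval σ)) (e.cost + 1)
  | store (σ : Memory) (a : ℕ) (i e : Expr) (hi : i.Fits W σ) (he : e.Fits W σ) :
      Exec W (.store a i e) σ (σ.setCell a (i.eval σ) (e.eval σ)) (i.cost + e.cost + 1)
  | seq {σ₁ σ₂ σ₃ : Memory} {c₁ c₂ : Program} {T₁ T₂ : ℕ}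
      (h₁ : Exec W c₁ σ₁ σ₂ T₁) (h₂ : Exec W c₂ σ₂ σ₃ T₂) :
      Exec W (.seq c₁ c₂) σ₁ σ₃ (T₁ + T₂)
  | ite_true {σ σ' : Memory} {b : Expr} {c₁ c₂ : Program} {T : ℕ} (hb : b.Fits W σ)
      (h : b.eval σ ≠ 0) (h₁ : Exec W c₁ σ σ' T) :
      Exec W (.ite b c₁ c₂) σ σ' (b.cost + 1 + T)
  | ite_false {σ σ' : Memory} {b : Expr} {c₁ c₂ : Program} {T : ℕ} (hb : b.Fits W σ)
      (h : b.eval σ = 0) (h₂ : Exec W c₂ σ σ' T) :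
      Exec W (.ite b c₁ c₂) σ σ' (b.cost + 1 + T)
  | loop_true {σ₁ σ₂ σ₃ : Memory} {b : Expr} {c : Program} {T₁ T₂ : ℕ} (hb : b.Fits W σ₁)
      (h : b.eval σ₁ ≠ 0) (h₁ : Exec W c σ₁ σ₂ T₁) (h₂ : Exec W (.loop b c) σ₂ σ₃ T₂) :
      Exec W (.loop b c) σ₁ σ₃ (b.cost + 1 + T₁ + T₂)
  | loop_false {σ : Memory} {b : Expr} {c : Program} (hb : b.Fits W σ) (h : b.eval σ = 0) :
      Exec W (.loop b c) σ σ (b.cost + 1)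

/-! ## Time-expanded cyclic graphs and flows -/

/-- The vertex `u_t`: node `u` at time slot `t`.  Slots are read modulo the length `Γ` of the
hypercycle, so that the slots `1, …, Γ` are the elements of `ZMod Γ`. -/
abbrev Vertex (V : Type*) (Γ : ℕ) := V × ZMod Γ

/-- A directed edge of a time-expanded cyclic graph. -/
abbrev Edge (V : Type*) (Γ : ℕ) := Vertex V Γ × Vertex V Γ

section

variable {V : Type*} [DecidableEq V] {Γ : ℕ}

/-- The edge `(u_t, v_{t+1})`; for `u = v` it is a storage edge. -/
def slotEdge (u v : V) (t : ZMod Γ) : Edge V Γ := ((u, t), (v, t + 1))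

/-- A communication edge joins different nodes. -/
def IsComm (e : Edge V Γ) : Prop := e.1.1 ≠ e.2.1

instance (e : Edge V Γ) : Decidable (IsComm e) := inferInstanceAs (Decidable (_ ≠ _))

/-- `A` is the edge set of a time-expanded cyclic graph over the network with link set `L`: it has
all storage edges `(u_t, u_{t+1})`, and its other edges are edges `(u_t, v_{t+1})` with `(u, v)` a
link (namely those for which the link is still available in slot `t`). -/
def IsTECG (L : Set (V × V)) (A : Finset (Edge V Γ)) : Prop :=
  (∀ u t, slotEdge u u t ∈ A) ∧
    ∀ e ∈ A, ∃ u v t, e = slotEdge u v t ∧ (u = v ∨ (u, v) ∈ L)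

/-- A flow: source, destination, arrival slot `γ` of the first packet, cycle length `λ` and maximum
allowed delay `ρ`. -/
structure Flow (V : Type*) where
  source : V
  target : V
  arrival : ℕ
  cycle : ℕ
  delay : ℕ

/-- Arrival slot of the `i`-th packet, `i = 1, 2, …`. -/
def Flow.packetArrival (f : Flow V) (i : ℕ) : ℕ := f.arrival + (i - 1) * f.cycle

/-- Deadline slot of the `i`-th packet: the last slot of its lifespan. -/
def Flow.packetDeadline (f : Flow V) (i : ℕ) : ℕ := f.packetArrival i + f.delay - 1

/-- The slots of the lifespan of the `i`-th packet. -/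
def Flow.lifespan (f : Flow V) (Γ i : ℕ) : Finset (ZMod Γ) :=
  (Finset.Icc (f.packetArrival i) (f.packetDeadline i)).image (fun j : ℕ => (j : ZMod Γ))

/-- The vertex at which the `i`-th packet starts. -/
def Flow.startVertex (f : Flow V) (Γ i : ℕ) : Vertex V Γ := (f.source, (f.packetArrival i : ZMod Γ))

/-- The vertex that the `i`-th packet has to reach. -/
def Flow.endVertex (f : Flow V) (Γ i : ℕ) : Vertex V Γ :=
  (f.target, ((f.packetDeadline i + 1 : ℕ) : ZMod Γ))

/-! ## Load status of edges -/

/-- The slots of the hypercycle in which the link `(u, v)` is occupied. -/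
def occupiedSlots [NeZero Γ] (A : Finset (Edge V Γ)) (u v : V) : Finset (ZMod Γ) :=
  Finset.univ.filter (fun t => slotEdge u v t ∉ A)

/-- Hypercycle-level load status of the link `(u, v)`. -/
def hyperLoad [NeZero Γ] (A : Finset (Edge V Γ)) (u v : V) : ℚ :=
  ((occupiedSlots A u v).card : ℚ) / Γ

/-- Packet-level load status of the link `(u, v)` for the `i`-th packet. -/
def packetLoad [NeZero Γ] (f : Flow V) (i : ℕ) (A : Finset (Edge V Γ)) (u v : V) : ℚ :=
  if f.delay < Γ then
    (((f.lifespan Γ i).filter (fun t => slotEdge u v t ∉ A)).card : ℚ) / f.delay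
  else hyperLoad A u v

/-- Combined load status of an edge for the `i`-th packet; it is `0` for storage edges. -/
def edgeLoad [NeZero Γ] (f : Flow V) (i : ℕ) (A : Finset (Edge V Γ)) (e : Edge V Γ) : ℚ :=
  if IsComm e then hyperLoad A e.1.1 e.2.1 + packetLoad f i A e.1.1 e.2.1 else 0

/-! ## The algorithm HFS-LLF -/

/-- `p` is the list of edges of a schedule path from `a` to `b` with edges in `A`. -/
def IsPath (A : Finset (Edge V Γ)) : Vertex V Γ → Vertex V Γ → List (Edge V Γ) → Prop
  | a, b, [] => a = b
  | a, b, e :: p => e ∈ A ∧ e.1 = a ∧ IsPath A e.2 b p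

/-- The edges of the slot right after the deadline of the `i`-th packet, which are set aside. -/
def setAside (f : Flow V) (i : ℕ) (A : Finset (Edge V Γ)) : Finset (Edge V Γ) :=
  A.filter (fun e => e.1.2 = ((f.packetDeadline i + 1 : ℕ) : ZMod Γ))

/-- `p` is a path that may be used for the `i`-th packet. -/
def IsPacketPath (f : Flow V) (i : ℕ) (A : Finset (Edge V Γ)) (p : List (Edge V Γ)) : Prop :=
  IsPath (A \ setAside f i A) (f.startVertex Γ i) (f.endVertex Γ i) p

/-- `p` is a shortest path for the `i`-th packet, with respect to the combined load status. -/
def IsLightestPath [NeZero Γ] (f : Flow V) (i : ℕ) (A : Finset (Edge V Γ))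
    (p : List (Edge V Γ)) : Prop :=
  IsPacketPath f i A p ∧
    ∀ p', IsPacketPath f i A p' → (p.map (edgeLoad f i A)).sum ≤ (p'.map (edgeLoad f i A)).sum

/-- The communication edges of `p` inside the lifespan of the `i`-th packet. -/
def usedEdges (f : Flow V) (i : ℕ) (p : List (Edge V Γ)) : Finset (Edge V Γ) :=
  p.toFinset.filter (fun e => IsComm e ∧ e.1.2 ∈ f.lifespan Γ i)

/-- `Run f i A P q A' P'`: a run of the main loop of HFS-LLF for the flow `f`, entered at packet `i`
with current edge set `A` and schedule paths `P` found so far, carries out `q` shortest-path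
computations and ends with edge set `A'` and output `P'` (`[]` if the flow is rejected).

In round `i`, the edges of the slot after the deadline are set aside.  If a path exists, a shortest
one is recorded, its communication edges are removed and the edges set aside are restored;
otherwise the edges of all recorded paths and those set aside are restored, and the algorithm
terminates with the empty output. -/
inductive Run [NeZero Γ] (f : Flow V) : ℕ → Finset (Edge V Γ) → List (List (Edge V Γ)) →
    ℕ → Finset (Edge V Γ) → List (List (Edge V Γ)) → Prop where
  | finish {i : ℕ} {A : Finset (Edge V Γ)} {P : List (List (Edge V Γ))}
      (hi : Γ / f.cycle < i) : Run f i A P 0 A P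
  | accept {i q : ℕ} {A A' : Finset (Edge V Γ)} {P P' : List (List (Edge V Γ))}
      {p : List (Edge V Γ)} (hi : i ≤ Γ / f.cycle) (hp : IsLightestPath f i A p)
      (h : Run f (i + 1) (((A \ setAside f i A) \ usedEdges f i p) ∪ setAside f i A)
        (P ++ [p]) q A' P') :
      Run f i A P (q + 1) A' P'
  | reject {i : ℕ} {A : Finset (Edge V Γ)} {P : List (List (Edge V Γ))}
      (hi : i ≤ Γ / f.cycle) (hp : ¬ ∃ p, IsPacketPath f i A p) :
      Run f i A P 1 (((A \ setAside f i A) ∪ P.flatten.toFinset) ∪ setAside f i A) []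

end

/-! ## Representation in memory -/

/-- The memory holds the network with nodes `0, …, n - 1` and links `link 0, …, link (m - 1)`
and the time-expanded cyclic graph with edge set `A`:
* registers `0, 1, 2`: `n`, `m`, `Γ`;
* arrays `0, 1`: tail and head of each link;
* array `2`: availability table, one bit for each slot and link;
* array `3`: for each link, the number of its occupied slots (its load label). -/
structure StoresGraph {n m Γ : ℕ} [NeZero Γ] (link : Fin m → Fin n × Fin n)
    (A : Finset (Edge (Fin n) Γ)) (σ : Memory) : Prop where
  nodes : σ.reg 0 = n
  links : σ.reg 1 = m
  slots : σ.reg 2 = Γ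
  tail : ∀ l : Fin m, σ.arr 0 l = (link l).1
  head : ∀ l : Fin m, σ.arr 1 l = (link l).2
  avail : ∀ (t : ZMod Γ) (l : Fin m), σ.arr 2 (t.val * m + l) =
    if slotEdge (link l).1 (link l).2 t ∈ A then 1 else 0
  occupied : ∀ l : Fin m, σ.arr 3 l = (occupiedSlots A (link l).1 (link l).2).card

/-- The memory holds the flow `f`, in registers `3, …, 7`. -/
structure StoresFlow {n : ℕ} (f : Flow (Fin n)) (σ : Memory) : Prop where
  source : σ.reg 3 = f.source
  target : σ.reg 4 = f.target
  arrival : σ.reg 5 = f.arrival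
  cycle : σ.reg 6 = f.cycle
  delay : σ.reg 7 = f.delay

/-- The memory holds the list `P` of schedule paths: register `8` is the number of paths, array `7`
their lengths, and for the `j`-th edge `(u_t, v_{t+1})` of path number `k` the cells `k * ρ + j` of
the arrays `4, 5, 6` are `u`, `v`, `t`. -/
structure StoresPaths {n Γ : ℕ} (ρ : ℕ) (P : List (List (Edge (Fin n) Γ))) (σ : Memory) :
    Prop where
  count : σ.reg 8 = P.length
  length : ∀ (k : ℕ) (hk : k < P.length), σ.arr 7 k = P[k].length ∧ P[k].length ≤ ρ
  tail : ∀ (k j : ℕ) (hk : k < P.length) (hj : j < P[k].length),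
    σ.arr 4 (k * ρ + j) = P[k][j].1.1
  head : ∀ (k j : ℕ) (hk : k < P.length) (hj : j < P[k].length),
    σ.arr 5 (k * ρ + j) = P[k][j].2.1
  slot : ∀ (k j : ℕ) (hk : k < P.length) (hj : j < P[k].length),
    σ.arr 6 (k * ρ + j) = P[k][j].1.2.val

end HFS

namespace HFS

/-! ## Reasoning about programs -/

/-! Every edge advances time by one slot, and once the edges leaving the layer of residue `γ_i + ρ`
are set aside, no path can continue past that layer. The start lies `ρ % Γ` steps before it, and the
target lies in it. Hence every admissible path has exactly `ρ % Γ` edges, one in each of the slots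
`γ_i, γ_i + 1, …` (`IsSuffixPath.slots`). This gives the confinement claim, since `ρ % Γ ≤ ρ`. It
also shows that the search graph is layered and acyclic although the time-expanded graph is cyclic.

Shortest paths are therefore found by dynamic programming backwards over the layers, without a
priority queue: one layer costs a scan of all nodes and all links. After multiplication by `Γ * ρ`
the weights are natural numbers at most `2 * Γ * ρ`, so the arithmetic is exact and polynomially
bounded. The distance table bounds every path from below (`IsTable.le_of_path`), and the recorded
first links give a path attaining the bound (`IsTable.suffixPath`); together they yield a lightest
path or a proof that none exists.

On the machine, one packet costs a count of occupied slots, the table, and the recording of one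
path, in total `O(ρ (|E| + |V|))`. A rejection adds one pass over the recorded paths. Because `|V| ≥
2`, `log |V|` is bounded below by a positive constant, so this is within the claimed bound.

Correctness of the program is proved by a small program logic: a frame rule from syntactic
footprints (`Exec.agree`), evaluation of loop-free code (`Program.Safe.meets`) and one rule for
counting loops (`Meets.forLoop`). -/

theorem Memory.reg_setReg (σ : Memory) (x w y : ℕ) :
    (σ.setReg x w).reg y = if y = x then w else σ.reg y := by
  simp [Memory.setReg, Function.update_apply]

theorem Memory.arr_setReg (σ : Memory) (x w : ℕ) : (σ.setReg x w).arr = σ.arr := rfl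

theorem Memory.reg_setCell (σ : Memory) (a i w : ℕ) : (σ.setCell a i w).reg = σ.reg := rfl

theorem Memory.arr_setCell (σ : Memory) (a i w b : ℕ) :
    (σ.setCell a i w).arr b = if b = a then Function.update (σ.arr a) i w else σ.arr b := by
  by_cases h : b = a
  · subst h; simp [Memory.setCell]
  · simp [Memory.setCell, h]

/-- The registers that a program may change. -/
def Program.regs : Program → List ℕ
  | .skip => []
  | .assign x _ => [x]
  | .store _ _ _ => []
  | .seq c₁ c₂ => c₁.regs ++ c₂.regs
  | .ite _ c₁ c₂ => c₁.regs ++ c₂.regs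
  | .loop _ c => c.regs

/-- The arrays that a program may change. -/
def Program.arrs : Program → List ℕ
  | .skip => []
  | .assign _ _ => []
  | .store a _ _ => [a]
  | .seq c₁ c₂ => c₁.arrs ++ c₂.arrs
  | .ite _ c₁ c₂ => c₁.arrs ++ c₂.arrs
  | .loop _ c => c.arrs

/-- Two memories agree outside the registers `R` and the arrays `S`. -/
structure Memory.Agree (R S : List ℕ) (σ σ' : Memory) : Prop where
  reg : ∀ x, x ∉ R → σ'.reg x = σ.reg x
  arr : ∀ a, a ∉ S → σ'.arr a = σ.arr a

theorem Memory.Agree.refl (R S : List ℕ) (σ : Memory) : Memory.Agree R S σ σ :=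
  ⟨fun _ _ => rfl, fun _ _ => rfl⟩

theorem Memory.Agree.trans {R S : List ℕ} {σ₁ σ₂ σ₃ : Memory} (h : Memory.Agree R S σ₁ σ₂)
    (h' : Memory.Agree R S σ₂ σ₃) : Memory.Agree R S σ₁ σ₃ :=
  ⟨fun x hx => (h'.reg x hx).trans (h.reg x hx), fun a ha => (h'.arr a ha).trans (h.arr a ha)⟩

theorem Memory.Agree.mono {R S R' S' : List ℕ} {σ₁ σ₂ : Memory} (h : Memory.Agree R S σ₁ σ₂)
    (hR : R ⊆ R') (hS : S ⊆ S') : Memory.Agree R' S' σ₁ σ₂ :=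
  ⟨fun x hx => h.reg x fun h' => hx (hR h'), fun a ha => h.arr a fun h' => ha (hS h')⟩

theorem Memory.Agree.setReg {R S : List ℕ} {σ₁ σ₂ : Memory} (h : Memory.Agree R S σ₁ σ₂)
    {x : ℕ} (hx : x ∈ R) (w : ℕ) : Memory.Agree R S σ₁ (σ₂.setReg x w) := by
  refine ⟨fun y hy => ?_, h.arr⟩
  have : y ≠ x := by rintro rfl; exact hy hx
  rw [Memory.reg_setReg, if_neg this, h.reg y hy]

/-- The frame rule. The footprints are explicit lists computed from the syntax, so for a concrete
program the fact that a register or array is untouched is settled by `decide`. -/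
theorem Exec.agree {W : ℕ} {c : Program} {σ σ' : Memory} {T : ℕ} (h : Exec W c σ σ' T) :
    Memory.Agree c.regs c.arrs σ σ' := by
  induction h with
  | skip => exact .refl _ _ _
  | assign σ x e he => exact (Memory.Agree.refl _ _ _).setReg (by simp [Program.regs]) _
  | store σ a i e hi he =>
    refine ⟨fun _ _ => rfl, fun b hb => ?_⟩
    have : b ≠ a := by simpa [Program.arrs] using hb
    rw [Memory.arr_setCell, if_neg this]
  | seq h₁ h₂ ih₁ ih₂ =>
    exact (ih₁.mono (by simp [Program.regs]) (by simp [Program.arrs])).trans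
      (ih₂.mono (by simp [Program.regs]) (by simp [Program.arrs]))
  | ite_true _ _ _ ih => exact ih.mono (by simp [Program.regs]) (by simp [Program.arrs])
  | ite_false _ _ _ ih => exact ih.mono (by simp [Program.regs]) (by simp [Program.arrs])
  | loop_true _ _ _ _ ih₁ ih₂ => exact Memory.Agree.trans ih₁ ih₂
  | loop_false => exact .refl _ _ _

/-- Started in `σ`, the program `c` halts within `T` steps in a memory that satisfies `Q`. -/
def Meets (W : ℕ) (c : Program) (σ : Memory) (T : ℕ) (Q : Memory → Prop) : Prop :=
  ∃ σ' t, Exec W c σ σ' t ∧ t ≤ T ∧ Q σ'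

/-- The rule of consequence with the frame built in: specifications need to mention only what a
program changes, and the rest is recovered from the agreement hypothesis. -/
theorem Meets.mono {W : ℕ} {c : Program} {σ : Memory} {T T' : ℕ} {Q Q' : Memory → Prop}
    (h : Meets W c σ T Q) (hT : T ≤ T')
    (hQ : ∀ σ', Memory.Agree c.regs c.arrs σ σ' → Q σ' → Q' σ') : Meets W c σ T' Q' := by
  obtain ⟨σ', t, he, ht, hq⟩ := h
  exact ⟨σ', t, he, ht.trans hT, hQ σ' he.agree hq⟩

theorem Meets.seq {W : ℕ} {c₁ c₂ : Program} {σ : Memory} {T₁ T₂ : ℕ} {Q₁ Q : Memory → Prop}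
    (h₁ : Meets W c₁ σ T₁ Q₁)
    (h₂ : ∀ σ', Memory.Agree c₁.regs c₁.arrs σ σ' → Q₁ σ' → Meets W c₂ σ' T₂ Q) :
    Meets W (.seq c₁ c₂) σ (T₁ + T₂) Q := by
  obtain ⟨σ₁, t₁, he, ht, hq⟩ := h₁
  obtain ⟨σ₂, t₂, he', ht', hq'⟩ := h₂ σ₁ he.agree hq
  exact ⟨σ₂, _, .seq he he', by omega, hq'⟩

theorem Meets.ite_true {W : ℕ} {b : Expr} {c₁ c₂ : Program} {σ : Memory} {T : ℕ}
    {Q : Memory → Prop} (hb : b.Fits W σ) (h : b.eval σ ≠ 0) (h₁ : Meets W c₁ σ T Q) :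
    Meets W (.ite b c₁ c₂) σ (b.cost + 1 + T) Q := by
  obtain ⟨σ₁, t₁, he, ht, hq⟩ := h₁
  exact ⟨σ₁, _, .ite_true hb h he, by omega, hq⟩

theorem Meets.ite_false {W : ℕ} {b : Expr} {c₁ c₂ : Program} {σ : Memory} {T : ℕ}
    {Q : Memory → Prop} (hb : b.Fits W σ) (h : b.eval σ = 0) (h₂ : Meets W c₂ σ T Q) :
    Meets W (.ite b c₁ c₂) σ (b.cost + 1 + T) Q := by
  obtain ⟨σ₁, t₁, he, ht, hq⟩ := h₂
  exact ⟨σ₁, _, .ite_false hb h he, by omega, hq⟩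

/-- The final memory of a program without loops. -/
def Program.run : Program → Memory → Memory
  | .skip, σ => σ
  | .assign x e, σ => σ.setReg x (e.eval σ)
  | .store a i e, σ => σ.setCell a (i.eval σ) (e.eval σ)
  | .seq c₁ c₂, σ => c₂.run (c₁.run σ)
  | .ite b c₁ c₂, σ => if b.eval σ = 0 then c₂.run σ else c₁.run σ
  | .loop _ _, σ => σ

/-- A program has no loops, and no overflow occurs in its execution. -/
def Program.Safe (W : ℕ) : Program → Memory → Prop
  | .skip, _ => True
  | .assign _ e, σ => e.Fits W σ
  | .store _ i e, σ => i.Fits W σ ∧ e.Fits W σ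
  | .seq c₁ c₂, σ => c₁.Safe W σ ∧ c₂.Safe W (c₁.run σ)
  | .ite b c₁ c₂, σ => b.Fits W σ ∧ if b.eval σ = 0 then c₂.Safe W σ else c₁.Safe W σ
  | .loop _ _, _ => False

/-- A bound for the running time of a program without loops. -/
def Program.time : Program → ℕ
  | .skip => 1
  | .assign _ e => e.cost + 1
  | .store _ i e => i.cost + e.cost + 1
  | .seq c₁ c₂ => c₁.time + c₂.time
  | .ite b c₁ c₂ => b.cost + 1 + max c₁.time c₂.time
  | .loop _ _ => 0

theorem Program.Safe.exec {W : ℕ} {c : Program} {σ : Memory} (h : c.Safe W σ) :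
    ∃ t, Exec W c σ (c.run σ) t ∧ t ≤ c.time := by
  induction c generalizing σ with
  | skip => exact ⟨_, .skip σ, le_rfl⟩
  | assign x e => exact ⟨_, .assign σ x e h, le_rfl⟩
  | store a i e => exact ⟨_, .store σ a i e h.1 h.2, le_rfl⟩
  | seq c₁ c₂ ih₁ ih₂ =>
    obtain ⟨t₁, h₁, ht₁⟩ := ih₁ h.1
    obtain ⟨t₂, h₂, ht₂⟩ := ih₂ h.2
    exact ⟨_, .seq h₁ h₂, Nat.add_le_add ht₁ ht₂⟩
  | ite b c₁ c₂ ih₁ ih₂ =>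
    obtain ⟨hb, h⟩ := h
    by_cases h0 : b.eval σ = 0
    · rw [if_pos h0] at h
      obtain ⟨t, h', ht⟩ := ih₂ h
      refine ⟨b.cost + 1 + t, ?_, by simp only [Program.time]; omega⟩
      rw [Program.run, if_pos h0]
      exact .ite_false hb h0 h'
    · rw [if_neg h0] at h
      obtain ⟨t, h', ht⟩ := ih₁ h
      refine ⟨b.cost + 1 + t, ?_, by simp only [Program.time]; omega⟩
      rw [Program.run, if_neg h0]
      exact .ite_true hb h0 h'
  | loop b c ih => exact h.elim

/-- Straight-line and branching code is deterministic, so it can be evaluated symbolically: what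
remains is an overflow condition, a comparison of times, and a property of an explicit memory. -/
theorem Program.Safe.meets {W : ℕ} {c : Program} {σ : Memory} {T : ℕ} {Q : Memory → Prop}
    (h : c.Safe W σ) (hT : c.time ≤ T) (hQ : Q (c.run σ)) : Meets W c σ T Q := by
  obtain ⟨t, he, ht⟩ := h.exec
  exact ⟨_, t, he, ht.trans hT, hQ⟩

theorem Meets.skip {W : ℕ} {σ : Memory} {Q : Memory → Prop} (h : Q σ) : Meets W .skip σ 1 Q :=
  ⟨σ, 1, .skip σ, le_rfl, h⟩

/-- `for x = 0, …, y - 1 do c`, where `y` is the value of a register. -/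
def Program.forLoop (x y : ℕ) (c : Program) : Program :=
  .seq (.assign x (.const 0))
    (.loop (.lt (.reg x) (.reg y)) (.seq c (.assign x (.add (.reg x) (.const 1)))))

/-- The invariant is stated for the memory in which the counter already holds its new value. Each
round costs 4 steps for the test and 4 for the increment besides the body; the 6 extra steps are the
initial assignment and the last, failing test. Strictness in `N < W` makes 1 a word even if `N = 0`.
-/
theorem Meets.forLoop {W x y N B : ℕ} {c : Program} {σ₀ : Memory} (I : ℕ → Memory → Prop)
    (hx : x ∉ c.regs) (hy : y ∉ c.regs) (hxy : y ≠ x) (hN : σ₀.reg y = N) (hW : N < W)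
    (h₀ : I 0 (σ₀.setReg x 0))
    (hs : ∀ i σ, i < N → Memory.Agree (x :: c.regs) c.arrs σ₀ σ → σ.reg x = i → I i σ →
      Meets W c σ B (fun σ' => I (i + 1) (σ'.setReg x (i + 1)))) :
    Meets W (Program.forLoop x y c) σ₀ (N * (B + 8) + 6) (I N) := by
  -- Induction on the number `k` of rounds still to come; agreement with `σ₀` is carried along so
  -- that the bound in register `y` stays `N`.
  have key : ∀ k i σ, i + k = N → Memory.Agree (x :: c.regs) c.arrs σ₀ σ → σ.reg x = i → I i σ →
      Meets W (.loop (.lt (.reg x) (.reg y)) (.seq c (.assign x (.add (.reg x) (.const 1))))) σ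
        (k * (B + 8) + 4) (I N) := by
    intro k
    induction k with
    | zero =>
      intro i σ hi ha hσ hI
      have hyσ : σ.reg y = N := by rw [ha.reg y (by simp [hxy, hy]), hN]
      obtain rfl : i = N := by omega
      exact ⟨σ, _, .loop_false (by simp only [Expr.Fits]; omega) (by simp [Expr.eval, hσ, hyσ]),
        by simp [Expr.cost], hI⟩
    | succ k ih =>
      intro i σ hi ha hσ hI
      have hyσ : σ.reg y = N := by rw [ha.reg y (by simp [hxy, hy]), hN]
      obtain ⟨σ₁, t₁, he, ht, hI'⟩ := hs i σ (by omega) ha hσ hI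
      have hσ₁ : σ₁.reg x = i := by rw [he.agree.reg x hx, hσ]
      have ha₁ : Memory.Agree (x :: c.regs) c.arrs σ₀ σ₁ :=
        ha.trans (he.agree.mono (by simp) (by simp))
      obtain ⟨σ₂, t₂, he₂, ht₂, hI₂⟩ := ih (i + 1) (σ₁.setReg x (i + 1)) (by omega)
        (ha₁.setReg (by simp) _) (by simp [Memory.reg_setReg]) hI'
      have hinc := Exec.assign (W := W) σ₁ x (.add (.reg x) (.const 1))
        (by simp only [Expr.Fits, Expr.eval, hσ₁]; omega)
      simp only [Expr.eval, hσ₁] at hinc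
      refine ⟨σ₂, _, .loop_true (by simp only [Expr.Fits]; omega) ?_ (.seq he hinc) he₂, ?_, hI₂⟩
      · simp only [Expr.eval, hσ, hyσ]; rw [if_pos (by omega)]; simp
      · simp only [Expr.cost, Nat.succ_mul]; omega
  obtain ⟨σ', t, he, ht, hI⟩ := key N 0 (σ₀.setReg x 0) (by omega)
    ((Memory.Agree.refl _ _ _).setReg (by simp) _) (by simp [Memory.reg_setReg]) h₀
  exact ⟨σ', _, .seq (.assign _ _ _ (Nat.zero_le _)) he, by simp only [Expr.cost]; omega, hI⟩

/-! ## Packet paths -/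

section

variable {V : Type*} {Γ : ℕ}

theorem packetDeadline_add_one {f : Flow V} (hρ : 1 ≤ f.delay) (i : ℕ) :
    f.packetDeadline i + 1 = f.packetArrival i + f.delay := by
  simp only [Flow.packetDeadline]; omega

theorem natCast_mem_lifespan {f : Flow V} (i : ℕ) {j : ℕ} (hj : j < f.delay) :
    ((f.packetArrival i + j : ℕ) : ZMod Γ) ∈ f.lifespan Γ i :=
  Finset.mem_image_of_mem _ (by simp only [Finset.mem_Icc, Flow.packetDeadline]; omega)

theorem IsPath.mem {A : Finset (Edge V Γ)} {a b : Vertex V Γ} {p : List (Edge V Γ)}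
    (h : IsPath A a b p) {e : Edge V Γ} (he : e ∈ p) : e ∈ A := by
  induction p generalizing a with
  | nil => simp at he
  | cons e' p ih =>
    rcases List.mem_cons.1 he with rfl | he
    · exact h.1
    · exact ih h.2.2 he

theorem natCast_add_mod (g ρ : ℕ) : ((g + ρ % Γ : ℕ) : ZMod Γ) = ((g + ρ : ℕ) : ZMod Γ) := by
  simp

theorem natCast_add_inj [NeZero Γ] {g j j' : ℕ} (hj : j < Γ) (hj' : j' < Γ)
    (h : ((g + j : ℕ) : ZMod Γ) = ((g + j' : ℕ) : ZMod Γ)) : j = j' := by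
  rw [ZMod.natCast_eq_natCast_iff] at h
  exact (Nat.ModEq.add_left_cancel' g h).eq_of_lt_of_lt hj hj'

/-- The first `ρ % Γ` slots from `g` on precede the first slot congruent to `g + ρ`, so none of them
is the slot that is set aside. -/
theorem natCast_add_ne [NeZero Γ] {g ρ j : ℕ} (hj : j < ρ % Γ) :
    ((g + j : ℕ) : ZMod Γ) ≠ ((g + ρ : ℕ) : ZMod Γ) := by
  have hr : ρ % Γ < Γ := Nat.mod_lt _ (NeZero.pos Γ)
  rw [← natCast_add_mod g ρ]
  intro h
  have := natCast_add_inj (by omega) hr h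
  omega

theorem mem_setAside {f : Flow V} (hρ : 1 ≤ f.delay) {i : ℕ} {A : Finset (Edge V Γ)}
    {e : Edge V Γ} : e ∈ setAside f i A ↔
      e ∈ A ∧ e.1.2 = ((f.packetArrival i + f.delay : ℕ) : ZMod Γ) := by
  rw [setAside, Finset.mem_filter, packetDeadline_add_one hρ]

/-- A lifespan shorter than the hypercycle does not wrap around, so its slots are distinct and
counting offsets counts slots. The bound is written `ρ % Γ`, which equals `ρ` here, because that is
the loop bound of the program. -/
theorem card_lifespan_filter [NeZero Γ] {f : Flow V} (hρ : 1 ≤ f.delay) (hΓ : f.delay < Γ) (i : ℕ)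
    (Q : ZMod Γ → Prop) [DecidablePred Q] : ((f.lifespan Γ i).filter Q).card =
      ((Finset.range (f.delay % Γ)).filter fun j =>
        Q ((f.packetArrival i + j : ℕ) : ZMod Γ)).card := by
  rw [Nat.mod_eq_of_lt hΓ]
  symm
  refine Finset.card_bij (fun j _ => ((f.packetArrival i + j : ℕ) : ZMod Γ)) ?_ ?_ ?_
  · intro j hj
    simp only [Finset.mem_filter, Finset.mem_range] at hj ⊢
    exact ⟨natCast_mem_lifespan i hj.1, hj.2⟩
  · intro j hj j' hj' h
    simp only [Finset.mem_filter, Finset.mem_range] at hj hj'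
    exact natCast_add_inj (by omega) (by omega) h
  · intro t ht
    simp only [Finset.mem_filter, Flow.lifespan, Finset.mem_image, Finset.mem_Icc,
      Flow.packetDeadline] at ht
    obtain ⟨⟨a, ha, rfl⟩, hq⟩ := ht
    have h : f.packetArrival i + (a - f.packetArrival i) = a := by omega
    refine ⟨a - f.packetArrival i, ?_, by rw [h]⟩
    simp only [Finset.mem_filter, Finset.mem_range, h]
    exact ⟨by omega, hq⟩

/-! ### The layered structure of the search graph -/

variable [DecidableEq V]

/-- `p` leads from the node `u` in slot number `j` of the lifespan to the destination. -/
def IsSuffixPath (f : Flow V) (i : ℕ) (A : Finset (Edge V Γ)) (j : ℕ) (u : V)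
    (p : List (Edge V Γ)) : Prop :=
  IsPath (A \ setAside f i A) (u, ((f.packetArrival i + j : ℕ) : ZMod Γ)) (f.endVertex Γ i) p

theorem isPacketPath_iff {f : Flow V} {i : ℕ} {A : Finset (Edge V Γ)} {p : List (Edge V Γ)} :
    IsPacketPath f i A p ↔ IsSuffixPath f i A 0 f.source p := Iff.rfl

/-- Layer `ρ % Γ` has the residue of the slot that is set aside, so no edge leaves it, and a path
from there must already have arrived. -/
theorem isSuffixPath_last [NeZero Γ] {f : Flow V} (hρ : 1 ≤ f.delay) {i : ℕ}
    {A : Finset (Edge V Γ)} {u : V} {p : List (Edge V Γ)} :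
    IsSuffixPath f i A (f.delay % Γ) u p ↔ u = f.target ∧ p = [] := by
  rw [IsSuffixPath, Flow.endVertex, packetDeadline_add_one hρ, natCast_add_mod]
  cases p with
  | nil => simp [IsPath]
  | cons e p =>
    simp only [IsPath, Finset.mem_sdiff, mem_setAside hρ]
    constructor
    · rintro ⟨⟨h, h'⟩, he, -⟩
      exact absurd ⟨h, by rw [he]⟩ h'
    · simp

/-- The recursion behind the dynamic program. Before the last layer the path cannot be empty, since
the target has another time residue, and its first edge is not affected by the setting aside. -/
theorem isSuffixPath_iff [NeZero Γ] {f : Flow V} (hρ : 1 ≤ f.delay) {i : ℕ} {L : Set (V × V)}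
    {A : Finset (Edge V Γ)} (hA : IsTECG L A) {j : ℕ} (hj : j < f.delay % Γ) {u : V}
    {p : List (Edge V Γ)} :
    IsSuffixPath f i A j u p ↔ ∃ v p', p = slotEdge u v ((f.packetArrival i + j : ℕ) : ZMod Γ) :: p'
      ∧ slotEdge u v ((f.packetArrival i + j : ℕ) : ZMod Γ) ∈ A ∧ IsSuffixPath f i A (j + 1) v p' := by
  have hne := natCast_add_ne (g := f.packetArrival i) hj
  cases p with
  | nil =>
    simp only [IsSuffixPath, Flow.endVertex, packetDeadline_add_one hρ, IsPath, Prod.mk.injEq]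
    constructor
    · rintro ⟨-, h⟩; exact absurd h hne
    · rintro ⟨_, _, h, -⟩; simp at h
  | cons e p =>
    simp only [IsSuffixPath, IsPath, Finset.mem_sdiff, mem_setAside hρ]
    constructor
    · rintro ⟨⟨heA, -⟩, he, hp⟩
      obtain ⟨u', v, t, rfl, -⟩ := hA.2 e heA
      simp only [slotEdge, Prod.mk.injEq] at he
      obtain ⟨rfl, rfl⟩ := he
      refine ⟨v, p, rfl, heA, ?_⟩
      simpa [slotEdge, add_assoc] using hp
    · rintro ⟨v, p', h, heA, hp⟩
      simp only [List.cons.injEq] at h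
      obtain ⟨rfl, rfl⟩ := h
      refine ⟨⟨heA, fun h => hne h.2⟩, rfl, ?_⟩
      simpa [slotEdge, add_assoc] using hp

theorem IsSuffixPath.slots [NeZero Γ] {f : Flow V} (hρ : 1 ≤ f.delay) {i : ℕ} {L : Set (V × V)}
    {A : Finset (Edge V Γ)} (hA : IsTECG L A) {k j : ℕ} (hj : j + k = f.delay % Γ) {u : V}
    {p : List (Edge V Γ)} (h : IsSuffixPath f i A j u p) :
    p.length = k ∧ ∀ e ∈ p, ∃ j' < f.delay % Γ,
      e.1.2 = ((f.packetArrival i + j' : ℕ) : ZMod Γ) := by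
  induction k generalizing j u p with
  | zero =>
    obtain rfl : j = f.delay % Γ := by omega
    rw [isSuffixPath_last hρ] at h
    simp [h.2]
  | succ k ih =>
    rw [isSuffixPath_iff hρ hA (by omega)] at h
    obtain ⟨v, p', rfl, -, h⟩ := h
    obtain ⟨hl, hs⟩ := ih (by omega) h
    refine ⟨by simp [hl], ?_⟩
    intro e he
    rcases List.mem_cons.1 he with rfl | he
    · exact ⟨j, by omega, rfl⟩
    · exact hs e he

theorem IsPacketPath.confined [NeZero Γ] {f : Flow V} (hρ : 1 ≤ f.delay) {i : ℕ} {L : Set (V × V)}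
    {A : Finset (Edge V Γ)} (hA : IsTECG L A) {p : List (Edge V Γ)} (h : IsPacketPath f i A p) :
    p.length ≤ f.delay ∧ ∀ e ∈ p, e.1.2 ∈ f.lifespan Γ i := by
  have hr : f.delay % Γ ≤ f.delay := Nat.mod_le _ _
  obtain ⟨hl, hs⟩ := IsSuffixPath.slots hρ hA (zero_add _) (isPacketPath_iff.1 h)
  refine ⟨hl.trans_le hr, fun e he => ?_⟩
  obtain ⟨j, hj, h⟩ := hs e he
  rw [h]
  exact natCast_mem_lifespan i (by omega)

/-- Confinement makes the bookkeeping collapse: the path avoids the edges set aside and lies in the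
lifespan. The program thus never has to set anything aside physically; it only stops its search at
layer `ρ % Γ`. -/
theorem IsPacketPath.accept_eq [NeZero Γ] {f : Flow V} (hρ : 1 ≤ f.delay) {i : ℕ} {L : Set (V × V)}
    {A : Finset (Edge V Γ)} (hA : IsTECG L A) {p : List (Edge V Γ)} (h : IsPacketPath f i A p) :
    ((A \ setAside f i A) \ usedEdges f i p) ∪ setAside f i A = A \ p.toFinset.filter IsComm := by
  ext e
  have h₁ : e ∈ p → e ∉ setAside f i A := fun he => (Finset.mem_sdiff.1 (IsPath.mem h he)).2
  have h₂ : e ∈ p → e.1.2 ∈ f.lifespan Γ i := (h.confined hρ hA).2 e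
  have h₃ : e ∈ setAside f i A → e ∈ A := fun h => (Finset.mem_filter.1 h).1
  simp only [usedEdges, Finset.mem_union, Finset.mem_sdiff, Finset.mem_filter, List.mem_toFinset]
  tauto

theorem reject_eq (f : Flow V) (i : ℕ) (A B : Finset (Edge V Γ)) :
    ((A \ setAside f i A) ∪ B) ∪ setAside f i A = A ∪ B := by
  ext e
  have h₃ : e ∈ setAside f i A → e ∈ A := fun h => (Finset.mem_filter.1 h).1
  simp only [Finset.mem_union, Finset.mem_sdiff]
  tauto

theorem IsTECG.sdiff {L : Set (V × V)} {A : Finset (Edge V Γ)} (hA : IsTECG L A)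
    (B : Finset (Edge V Γ)) : IsTECG L (A \ B.filter IsComm) := by
  refine ⟨fun u t => ?_, fun e he => hA.2 e (Finset.mem_sdiff.1 he).1⟩
  exact Finset.mem_sdiff.2 ⟨hA.1 u t, by simp [IsComm, slotEdge]⟩

/-! ## Integral weights -/

/-- The combined load status of a link for the `i`-th packet, multiplied by `Γ * ρ`. -/
def linkWeight [NeZero Γ] (f : Flow V) (i : ℕ) (A : Finset (Edge V Γ)) (u v : V) : ℕ :=
  if f.delay < Γ then
    (occupiedSlots A u v).card * f.delay +
      ((Finset.range (f.delay % Γ)).filter fun j =>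
        slotEdge u v ((f.packetArrival i + j : ℕ) : ZMod Γ) ∉ A).card * Γ
  else (occupiedSlots A u v).card * f.delay * 2

/-- `Γ * ρ` is a common denominator of the two loads. A positive common factor does not affect which
paths are lightest, so integral weights suffice. -/
theorem edgeLoad_mul [NeZero Γ] {f : Flow V} (hρ : 1 ≤ f.delay) (i : ℕ) (A : Finset (Edge V Γ))
    {u v : V} (huv : u ≠ v) (t : ZMod Γ) :
    edgeLoad f i A (slotEdge u v t) * ((Γ * f.delay : ℕ) : ℚ) = linkWeight f i A u v := by
  have h₁ : (Γ : ℚ) ≠ 0 := Nat.cast_ne_zero.2 (NeZero.ne Γ)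
  have h₂ : (f.delay : ℚ) ≠ 0 := Nat.cast_ne_zero.2 (by omega)
  rw [edgeLoad, if_pos (show IsComm (slotEdge u v t) from huv)]
  change (hyperLoad A u v + packetLoad f i A u v) * _ = _
  simp only [packetLoad, hyperLoad, linkWeight]
  split_ifs with hΓ
  · rw [card_lifespan_filter hρ hΓ i fun t => slotEdge u v t ∉ A]
    push_cast
    field_simp
  · push_cast
    field_simp
    ring

theorem edgeLoad_storage [NeZero Γ] (f : Flow V) (i : ℕ) (A : Finset (Edge V Γ)) (u : V)
    (t : ZMod Γ) : edgeLoad f i A (slotEdge u u t) = 0 := by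
  simp [edgeLoad, IsComm, slotEdge]

theorem linkWeight_le [NeZero Γ] (f : Flow V) (i : ℕ) (A : Finset (Edge V Γ)) (u v : V) :
    linkWeight f i A u v ≤ 2 * (Γ * f.delay) := by
  have h₁ : (occupiedSlots A u v).card ≤ Γ := by
    simpa [ZMod.card] using Finset.card_le_univ (occupiedSlots A u v)
  have h₂ : ((Finset.range (f.delay % Γ)).filter fun j =>
        slotEdge u v ((f.packetArrival i + j : ℕ) : ZMod Γ) ∉ A).card ≤ f.delay :=
    (Finset.card_filter_le _ _).trans (by simpa using Nat.mod_le _ _)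
  rw [linkWeight]
  split_ifs
  · nlinarith
  · nlinarith

end

/-! ## Shortest paths by dynamic programming -/

section

variable {n m Γ : ℕ} {link : Fin m → Fin n × Fin n} {A : Finset (Edge (Fin n) Γ)}

/-- `D'` holds the distances to the destination from the nodes of slot `t + 1`, increased by one,
where `0` stands for infinity.  `D` and `nx` hold the distances from the nodes of slot `t` and the
first links of shortest paths, if only the links with numbers below `k` may be used in slot `t`.
The value `m` of `nx` stands for a storage edge. -/
structure IsLayer (link : Fin m → Fin n × Fin n) (A : Finset (Edge (Fin n) Γ)) (t : ZMod Γ)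
    (w : Fin m → ℕ) (k : ℕ) (D D' nx : ℕ → ℕ) : Prop where
  stay : ∀ u : Fin n, D' u ≠ 0 → D u ≠ 0 ∧ D u ≤ D' u
  relax : ∀ l : Fin m, l.val < k → slotEdge (link l).1 (link l).2 t ∈ A → D' (link l).2 ≠ 0 →
    D (link l).1 ≠ 0 ∧ D (link l).1 ≤ D' (link l).2 + w l
  sound : ∀ u : Fin n, D u ≠ 0 → nx u = m ∧ D u = D' u ∨
    ∃ l : Fin m, nx u = l ∧ (link l).1 = u ∧ slotEdge (link l).1 (link l).2 t ∈ A ∧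
      D' (link l).2 ≠ 0 ∧ D u = D' (link l).2 + w l

theorem IsLayer.init {t : ZMod Γ} {w : Fin m → ℕ} {D D' nx : ℕ → ℕ}
    (hD : ∀ u : Fin n, D u = D' u) (hnx : ∀ u : Fin n, nx u = m) :
    IsLayer link A t w 0 D D' nx :=
  ⟨fun u h => ⟨by rwa [hD], (hD u).le⟩, fun l h => absurd h (Nat.not_lt_zero _),
    fun u _ => .inl ⟨hnx u, hD u⟩⟩

/-- The case in which link `l` brings no improvement: it is occupied, leads to a node of infinite
distance, or already satisfies its inequality. -/
theorem IsLayer.skip {t : ZMod Γ} {w : Fin m → ℕ} {D D' nx : ℕ → ℕ} {l : Fin m}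
    (h : IsLayer link A t w l D D' nx)
    (hl : slotEdge (link l).1 (link l).2 t ∈ A → D' (link l).2 ≠ 0 →
      D (link l).1 ≠ 0 ∧ D (link l).1 ≤ D' (link l).2 + w l) :
    IsLayer link A t w (l + 1) D D' nx := by
  refine ⟨h.stay, fun l' hl' => ?_, h.sound⟩
  rcases Nat.lt_succ_iff_lt_or_eq.1 hl' with h' | h'
  · exact h.relax l' h'
  · obtain rfl : l' = l := Fin.ext h'
    exact hl

/-- The entry of the tail only decreases, or becomes finite, so the inequalities of earlier links
survive. The row `D'` of the next slot is not touched, which is why a single pass over the links is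
enough. -/
theorem IsLayer.update {t : ZMod Γ} {w : Fin m → ℕ} {D D' nx : ℕ → ℕ} {l : Fin m}
    (h : IsLayer link A t w l D D' nx) (hA : slotEdge (link l).1 (link l).2 t ∈ A)
    (h₀ : D' (link l).2 ≠ 0) (hl : D (link l).1 = 0 ∨ D' (link l).2 + w l < D (link l).1) :
    IsLayer link A t w (l + 1) (Function.update D (link l).1 (D' (link l).2 + w l)) D'
      (Function.update nx (link l).1 l) := by
  refine ⟨fun u hu => ?_, fun l' hl' hA' h₀' => ?_, fun u hu => ?_⟩
  · have := h.stay u hu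
    by_cases hul : (u : ℕ) = (link l).1
    · rw [hul] at this
      rw [hul, Function.update_self]
      omega
    · rwa [Function.update_of_ne hul]
  · by_cases hul : ((link l').1 : ℕ) = (link l).1
    · rw [hul, Function.update_self]
      rcases Nat.lt_succ_iff_lt_or_eq.1 hl' with h' | h'
      · have := h.relax l' h' hA' h₀'
        rw [hul] at this
        omega
      · obtain rfl : l' = l := Fin.ext h'
        omega
    · rw [Function.update_of_ne hul]
      rcases Nat.lt_succ_iff_lt_or_eq.1 hl' with h' | h'
      · exact h.relax l' h' hA' h₀'
      · exact absurd (by rw [Fin.ext h']) hul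
  · by_cases hul : (u : ℕ) = (link l).1
    · rw [hul, Function.update_self, Function.update_self]
      exact .inr ⟨l, rfl, (Fin.ext hul).symm, hA, h₀, rfl⟩
    · rw [Function.update_of_ne hul] at hu ⊢
      rw [Function.update_of_ne hul]
      exact h.sound u hu

theorem IsLayer.le {t : ZMod Γ} {w : Fin m → ℕ} {k : ℕ} {D D' nx : ℕ → ℕ}
    (h : IsLayer link A t w k D D' nx) {b M : ℕ} (hw : ∀ l, w l ≤ M)
    (hD' : ∀ u : Fin n, D' u ≤ b) (u : Fin n) : D u ≤ b + M := by
  by_cases hu : D u = 0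
  · omega
  · rcases h.sound u hu with ⟨-, h'⟩ | ⟨l, -, -, -, -, h'⟩
    · have := hD' u; omega
    · have := hD' (link l).2; have := hw l; omega

variable [NeZero Γ]

/-- Tables of distances to the destination and of first links of shortest paths, for all slots
of the lifespan of the `i`-th packet that a path may use. -/
structure IsTable (link : Fin m → Fin n × Fin n) (A : Finset (Edge (Fin n) Γ)) (f : Flow (Fin n))
    (i : ℕ) (D nx : ℕ → ℕ → ℕ) : Prop where
  last : ∀ u : Fin n, D (f.delay % Γ) u = if u = f.target then 1 else 0
  layer : ∀ j < f.delay % Γ, IsLayer link A ((f.packetArrival i + j : ℕ) : ZMod Γ)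
    (fun l => linkWeight f i A (link l).1 (link l).2) m (D j) (D (j + 1)) (nx j)

/-- The nodes met when the table `nx` of links is followed from `s`. -/
def route (link : Fin m → Fin n × Fin n) (nx : ℕ → ℕ → ℕ) (s : Fin n) : ℕ → Fin n
  | 0 => s
  | j + 1 => if h : nx j (route link nx s j) < m then (link ⟨_, h⟩).2 else route link nx s j

/-- The edge of a route in slot number `j` after slot `g`. -/
def routeEdge (link : Fin m → Fin n × Fin n) (nx : ℕ → ℕ → ℕ) (s : Fin n) (g j : ℕ) :
    Edge (Fin n) Γ :=
  slotEdge (route link nx s j) (route link nx s (j + 1)) ((g + j : ℕ) : ZMod Γ)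

variable {f : Flow (Fin n)} {i : ℕ} {D nx : ℕ → ℕ → ℕ}

/-- The lower bound half of optimality, by induction from the last layer backwards: a storage edge
uses `stay`, a communication edge uses `relax`. The summand 1 is the shift that frees the value 0 to
stand for infinity. -/
theorem IsTable.le_of_path (hT : IsTable link A f i D nx) (hρ : 1 ≤ f.delay)
    (hlink : ∀ l, (link l).1 ≠ (link l).2) (hA : IsTECG (Set.range link) A) {k j : ℕ}
    (hj : j + k = f.delay % Γ) {u : Fin n} {p : List (Edge (Fin n) Γ)}
    (hp : IsSuffixPath f i A j u p) :
    D j u ≠ 0 ∧ (D j u : ℚ) ≤ 1 + (p.map (edgeLoad f i A)).sum * ((Γ * f.delay : ℕ) : ℚ) := by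
  induction k generalizing j u p with
  | zero =>
    obtain rfl : j = f.delay % Γ := by omega
    rw [isSuffixPath_last hρ] at hp
    obtain ⟨rfl, rfl⟩ := hp
    simp [hT.last]
  | succ k ih =>
    rw [isSuffixPath_iff hρ hA (by omega)] at hp
    obtain ⟨v, p', rfl, he, hp⟩ := hp
    obtain ⟨h₀, h₁⟩ := ih (by omega) hp
    have hL := hT.layer j (by omega)
    obtain ⟨u', v', t, h, h'⟩ := hA.2 _ he
    simp only [slotEdge, Prod.mk.injEq] at h
    obtain ⟨⟨rfl, -⟩, rfl, -⟩ := h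
    rcases h' with rfl | ⟨l, hl⟩
    · have := hL.stay u h₀
      refine ⟨this.1, le_trans (Nat.cast_le.2 this.2) ?_⟩
      simpa [edgeLoad_storage] using h₁
    · obtain ⟨rfl, rfl⟩ : (link l).1 = u ∧ (link l).2 = v := by rw [hl]; exact ⟨rfl, rfl⟩
      have := hL.relax l l.2 he h₀
      refine ⟨this.1, le_trans (Nat.cast_le.2 this.2) ?_⟩
      rw [List.map_cons, List.sum_cons, add_mul, edgeLoad_mul hρ i A (hlink l)]
      push_cast at h₁ ⊢
      linarith

/-- Finiteness of the distance propagates along the route, and the distance drops by exactly the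
weight of the edge taken; both come from `sound`. -/
theorem IsTable.route_succ (hT : IsTable link A f i D nx) (hA : IsTECG (Set.range link) A)
    {s : Fin n} {j : ℕ} (hj : j < f.delay % Γ) (hD : D j (route link nx s j) ≠ 0) :
    D (j + 1) (route link nx s (j + 1)) ≠ 0 ∧
    routeEdge link nx s (f.packetArrival i) j ∈ A ∧
    (nx j (route link nx s j) = m ∧ route link nx s (j + 1) = route link nx s j ∧
      D j (route link nx s j) = D (j + 1) (route link nx s (j + 1)) ∨
    ∃ l : Fin m, nx j (route link nx s j) = l ∧ route link nx s j = (link l).1 ∧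
      route link nx s (j + 1) = (link l).2 ∧ D j (route link nx s j) =
        D (j + 1) (route link nx s (j + 1)) + linkWeight f i A (link l).1 (link l).2) := by
  rcases (hT.layer j hj).sound _ hD with ⟨h₁, h₂⟩ | ⟨l, h₁, h₂, h₃, h₄, h₅⟩
  · have h : route link nx s (j + 1) = route link nx s j := by simp [route, h₁]
    rw [routeEdge, h]
    exact ⟨by rwa [← h₂], hA.1 _ _, .inl ⟨h₁, rfl, h₂⟩⟩
  · have h : route link nx s (j + 1) = (link l).2 := by simp [route, h₁]
    rw [routeEdge, h, ← h₂]
    rw [← h₂] at h₁ h₅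
    exact ⟨h₄, h₃, .inr ⟨l, h₁, rfl, rfl, h₅⟩⟩

theorem IsTable.route_ne_zero (hT : IsTable link A f i D nx) (hA : IsTECG (Set.range link) A)
    {s : Fin n} (hD : D 0 s ≠ 0) {j : ℕ} (hj : j ≤ f.delay % Γ) :
    D j (route link nx s j) ≠ 0 := by
  induction j with
  | zero => exact hD
  | succ j ih => exact (hT.route_succ hA hj (ih (by omega))).1

/-- The attainment half of optimality: the drops of the distance telescope to the weight of the
route, and a finite distance in the last layer forces the route to end at the destination. -/
theorem IsTable.suffixPath (hT : IsTable link A f i D nx) (hρ : 1 ≤ f.delay)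
    (hlink : ∀ l, (link l).1 ≠ (link l).2) (hA : IsTECG (Set.range link) A) {s : Fin n}
    (hD : D 0 s ≠ 0) {k j : ℕ} (hj : j + k = f.delay % Γ) :
    IsSuffixPath f i A j (route link nx s j)
      ((List.range' j k).map (routeEdge link nx s (f.packetArrival i))) ∧
    (D j (route link nx s j) : ℚ) = 1 + (((List.range' j k).map
      (routeEdge link nx s (f.packetArrival i))).map (edgeLoad f i A)).sum *
        ((Γ * f.delay : ℕ) : ℚ) := by
  induction k generalizing j with
  | zero =>
    obtain rfl : j = f.delay % Γ := by omega
    have h := hT.route_ne_zero hA hD le_rfl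
    rw [hT.last] at h ⊢
    have h : route link nx s (f.delay % Γ) = f.target := by by_contra h'; simp [h'] at h
    rw [isSuffixPath_last hρ]
    simp [h]
  | succ k ih =>
    obtain ⟨hp, hs⟩ := ih (j := j + 1) (by omega)
    obtain ⟨-, he, h⟩ := hT.route_succ hA (by omega) (hT.route_ne_zero hA hD (j := j) (by omega))
    rw [List.range'_succ, List.map_cons, List.map_cons, List.sum_cons]
    refine ⟨(isSuffixPath_iff hρ hA (by omega)).2 ⟨_, _, rfl, he, hp⟩, ?_⟩
    rw [add_mul, add_left_comm, ← hs, routeEdge]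
    rcases h with ⟨-, h₁, h₂⟩ | ⟨l, -, h₁, h₂, h₃⟩
    · rw [h₂, h₁, edgeLoad_storage]; simp
    · rw [h₃, h₁, h₂, edgeLoad_mul hρ i A (hlink l)]; push_cast; ring

theorem IsTable.isLightestPath (hT : IsTable link A f i D nx) (hρ : 1 ≤ f.delay)
    (hlink : ∀ l, (link l).1 ≠ (link l).2) (hA : IsTECG (Set.range link) A)
    (hD : D 0 f.source ≠ 0) : IsLightestPath f i A ((List.range' 0 (f.delay % Γ)).map
      (routeEdge link nx f.source (f.packetArrival i))) := by
  obtain ⟨hp, hs⟩ := hT.suffixPath hρ hlink hA hD (zero_add _)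
  refine ⟨hp, fun p' hp' => ?_⟩
  have h := (hT.le_of_path hρ hlink hA (zero_add _) (isPacketPath_iff.1 hp')).2
  rw [show D 0 f.source = D 0 (route link nx f.source 0) from rfl, hs] at h
  have hpos : (0 : ℚ) < ((Γ * f.delay : ℕ) : ℚ) :=
    Nat.cast_pos.2 (Nat.mul_pos (NeZero.pos Γ) hρ)
  exact le_of_mul_le_mul_right (by linarith) hpos

theorem IsTable.not_exists_path (hT : IsTable link A f i D nx) (hρ : 1 ≤ f.delay)
    (hlink : ∀ l, (link l).1 ≠ (link l).2) (hA : IsTECG (Set.range link) A)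
    (hD : D 0 f.source = 0) : ¬ ∃ p, IsPacketPath f i A p := by
  rintro ⟨p, hp⟩
  exact (hT.le_of_path hρ hlink hA (zero_add _) (isPacketPath_iff.1 hp)).1 hD

end

/-! ## The program

Besides the registers and arrays of the representation, the program uses
* registers `9`: rejection flag; `10`: `ρ % Γ`; `11`: `Γ / λ`; `12`: packet counter; `13`: arrival
  slot of the packet; `14`, `15`: loop counters; `16`: row of the availability table; `17`, `18`:
  rows of the tables of distances and links; `19`: current node; `20`, `21`, `22`: scratch;
* array `8`: link of each path edge; arrays `9`, `10`: tables of distances (increased by one, `0` for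
  infinity) and of first links of shortest paths; array `11`: scaled weights of the links. -/

/-- Every number that the program computes is a word. -/
structure Wide (n m Γ ρ W : ℕ) : Prop where
  basic : n + m + 3 * Γ + ρ + 3 ≤ W
  avail : (Γ + 1) * m ≤ W
  rows : (Γ + 1) * n ≤ W
  paths : (Γ + 1) * ρ ≤ W
  dist : (Γ + 1) * (2 * (Γ * ρ)) + 1 ≤ W

/-- The registers whose contents do not change in the main loop. -/
structure StoresInput {n : ℕ} (m Γ : ℕ) (f : Flow (Fin n)) (σ : Memory) : Prop
    extends StoresFlow f σ where
  nodes : σ.reg 0 = n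
  links : σ.reg 1 = m
  slots : σ.reg 2 = Γ
  depth : σ.reg 10 = f.delay % Γ
  packets : σ.reg 11 = Γ / f.cycle

theorem StoresInput.agree {n m Γ : ℕ} {f : Flow (Fin n)} {σ σ' : Memory} {R S : List ℕ}
    (h : StoresInput m Γ f σ) (ha : Memory.Agree R S σ σ')
    (hR : ∀ x ∈ [0, 1, 2, 3, 4, 5, 6, 7, 10, 11], x ∉ R) : StoresInput m Γ f σ' := by
  constructor
  · constructor
    · rw [ha.reg _ (hR _ (by simp)), h.source]
    · rw [ha.reg _ (hR _ (by simp)), h.target]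
    · rw [ha.reg _ (hR _ (by simp)), h.arrival]
    · rw [ha.reg _ (hR _ (by simp)), h.cycle]
    · rw [ha.reg _ (hR _ (by simp)), h.delay]
  · rw [ha.reg _ (hR _ (by simp)), h.nodes]
  · rw [ha.reg _ (hR _ (by simp)), h.links]
  · rw [ha.reg _ (hR _ (by simp)), h.slots]
  · rw [ha.reg _ (hR _ (by simp)), h.depth]
  · rw [ha.reg _ (hR _ (by simp)), h.packets]

theorem StoresGraph.agree {n m Γ : ℕ} [NeZero Γ] {link : Fin m → Fin n × Fin n}
    {A : Finset (Edge (Fin n) Γ)} {σ σ' : Memory} {R S : List ℕ}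
    (h : StoresGraph link A σ) (ha : Memory.Agree R S σ σ') (hR : ∀ x ∈ [0, 1, 2], x ∉ R)
    (hS : ∀ a ∈ [0, 1, 2, 3], a ∉ S) : StoresGraph link A σ' := by
  constructor
  · rw [ha.reg _ (hR _ (by simp)), h.nodes]
  · rw [ha.reg _ (hR _ (by simp)), h.links]
  · rw [ha.reg _ (hR _ (by simp)), h.slots]
  · rw [ha.arr _ (hS _ (by simp))]; exact h.tail
  · rw [ha.arr _ (hS _ (by simp))]; exact h.head
  · rw [ha.arr _ (hS _ (by simp))]; exact h.avail
  · rw [ha.arr _ (hS _ (by simp))]; exact h.occupied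

/-- Register `16` receives the row of the availability table for the slot at hand. -/
def loadSlotRow : Program :=
  .assign 16 (.mul (.mod (.add (.reg 13) (.reg 14)) (.reg 2)) (.reg 1))

/-- Count the occupied slots of each link in the first `ρ % Γ` slots of the lifespan. -/
def countOccupied : Program :=
  .seq (.forLoop 15 1 (.store 11 (.reg 15) (.const 0)))
    (.forLoop 14 10 (.seq loadSlotRow (.forLoop 15 1
      (.store 11 (.reg 15) (.add (.cell 11 (.reg 15))
        (.sub (.const 1) (.cell 2 (.add (.reg 16) (.reg 15)))))))))

/-- Compute the scaled weights of all links. -/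
def computeWeights : Program :=
  .seq countOccupied
    (.forLoop 15 1 (.ite (.lt (.reg 7) (.reg 2))
      (.store 11 (.reg 15) (.add (.mul (.cell 3 (.reg 15)) (.reg 7))
        (.mul (.cell 11 (.reg 15)) (.reg 2))))
      (.store 11 (.reg 15) (.mul (.mul (.cell 3 (.reg 15)) (.reg 7)) (.const 2)))))

/-! ### Correctness of the weight computation -/

section

variable {n m Γ : ℕ} [NeZero Γ] {link : Fin m → Fin n × Fin n} {A : Finset (Edge (Fin n) Γ)}
  {f : Flow (Fin n)} {W : ℕ} {σ : Memory}

theorem StoresGraph.avail_natCast (hG : StoresGraph link A σ) (g : ℕ) (l : Fin m) :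
    σ.arr 2 (g % Γ * m + l) =
      if slotEdge (link l).1 (link l).2 ((g : ℕ) : ZMod Γ) ∈ A then 1 else 0 := by
  rw [← hG.avail, ZMod.val_natCast]

theorem StoresGraph.avail_le (hG : StoresGraph link A σ) (g : ℕ) (l : Fin m) :
    σ.arr 2 (g % Γ * m + l) ≤ 1 := by
  rw [hG.avail_natCast]; split_ifs <;> omega

theorem Wide.slotRow {ρ : ℕ} (hW : Wide n m Γ ρ W) (g : ℕ) : g % Γ * m + m ≤ W := by
  have h : g % Γ + 1 ≤ Γ + 1 := by have := Nat.mod_lt g (NeZero.pos Γ); omega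
  calc g % Γ * m + m = (g % Γ + 1) * m := by ring
    _ ≤ (Γ + 1) * m := Nat.mul_le_mul_right _ h
    _ ≤ W := hW.avail

theorem loadSlotRow_meets {ρ : ℕ} (hW : Wide n m Γ ρ W) {g j : ℕ} (hg : g + j < W)
    (h13 : σ.reg 13 = g) (h14 : σ.reg 14 = j) (h1 : σ.reg 1 = m) (h2 : σ.reg 2 = Γ) :
    Meets W loadSlotRow σ 8 (fun σ' => σ'.reg 16 = (g + j) % Γ * m) := by
  have h := hW.slotRow (g + j)
  have := hW.basic
  have := Nat.mod_lt (g + j) (NeZero.pos Γ)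
  refine Program.Safe.meets ?_ (by decide) ?_
  · simp only [loadSlotRow, Program.Safe, Expr.Fits, Expr.eval, h13, h14, h1, h2]
    omega
  · simp [loadSlotRow, Program.run, Expr.eval, h13, h14, h1, h2, Memory.reg_setReg]

theorem countOccupied_meets (hW : Wide n m Γ f.delay W) (hG : StoresGraph link A σ)
    (hI : StoresInput m Γ f σ) {g : ℕ} (h13 : σ.reg 13 = g) (hg : g + Γ < W) :
    Meets W countOccupied σ
      ((m * (3 + 8) + 6) + (f.delay % Γ * (8 + (m * (11 + 8) + 6) + 8) + 6))
      (fun σ' => ∀ l : Fin m, σ'.arr 11 l = ((Finset.range (f.delay % Γ)).filter fun j =>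
        slotEdge (link l).1 (link l).2 ((g + j : ℕ) : ZMod Γ) ∉ A).card) := by
  have hb := hW.basic
  have hrΓ : f.delay % Γ < Γ := Nat.mod_lt _ (NeZero.pos Γ)
  refine Meets.seq (Q₁ := fun σ' => ∀ l : Fin m, σ'.arr 11 l = 0) ?_ ?_
  · refine (Meets.forLoop (N := m) (fun k σ' => ∀ l : Fin m, l.val < k → σ'.arr 11 l = 0)
      (by decide) (by decide) (by decide) hI.links (by omega) (by simp) ?_).mono le_rfl
      (fun σ' _ h l => h l l.2)
    intro k σ₁ hk ha h15 h
    refine Program.Safe.meets ?_ (by decide) ?_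
    · simp only [Program.Safe, Expr.Fits, h15]; omega
    · intro l hl
      simp only [Program.run, Expr.eval, h15, Memory.arr_setReg, Memory.arr_setCell, if_true,
        Function.update_apply]
      split_ifs with h'
      · rfl
      · exact h l (by omega)
  · intro σ₁ ha h₀
    refine Meets.forLoop (fun J σ' => ∀ l : Fin m, σ'.arr 11 l =
      ((Finset.range J).filter fun j =>
        slotEdge (link l).1 (link l).2 ((g + j : ℕ) : ZMod Γ) ∉ A).card)
      (by decide) (by decide) (by decide) ?_ (by omega) (by simpa [Memory.arr_setReg] using h₀) ?_
    · rw [ha.reg _ (by decide), hI.depth]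
    intro J σ₂ hJ ha₂ h14 h
    have hG₂ := (hG.agree ha (by decide) (by decide)).agree ha₂ (by decide) (by decide)
    refine Meets.seq (loadSlotRow_meets hW (g := g) (j := J) (by omega)
      (by rw [ha₂.reg _ (by decide), ha.reg _ (by decide), h13]) h14 hG₂.links hG₂.slots) ?_
    intro σ₃ ha₃ h16
    have hG₃ := hG₂.agree ha₃ (by decide) (by decide)
    have hrow := hW.slotRow (g + J)
    -- Within the pass for slot `J`, links below `k` have been counted through slot `J`, the others
    -- only up to the slot before.
    refine (Meets.forLoop (N := m) (fun k σ' => ∀ l : Fin m, σ'.arr 11 l =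
      ((Finset.range (if l.val < k then J + 1 else J)).filter fun j =>
        slotEdge (link l).1 (link l).2 ((g + j : ℕ) : ZMod Γ) ∉ A).card)
      (by decide) (by decide) (by decide) hG₃.links (by omega) ?_ ?_).mono le_rfl ?_
    · intro l
      simp only [Memory.arr_setReg, Nat.not_lt_zero, if_false]
      rw [ha₃.arr _ (by decide), h]
    · intro k σ₄ hk ha₄ h15 h'
      have hG₄ := hG₃.agree ha₄ (by decide) (by decide)
      have h16' : σ₄.reg 16 = (g + J) % Γ * m := by rw [ha₄.reg _ (by decide), h16]
      have hav := hG₄.avail_natCast (g + J) ⟨k, hk⟩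
      have hk' := h' ⟨k, hk⟩
      simp only [lt_irrefl, if_false] at hk' hav
      have hc : ((Finset.range J).filter fun j => slotEdge (link ⟨k, hk⟩).1 (link ⟨k, hk⟩).2
        ((g + j : ℕ) : ZMod Γ) ∉ A).card ≤ J :=
        (Finset.card_filter_le _ _).trans (by simp)
      have hbit := hG₄.avail_le (g + J) ⟨k, hk⟩
      simp only at hbit
      refine Program.Safe.meets ?_ (by decide) ?_
      · simp only [Program.Safe, Expr.Fits, Expr.eval, h15, h16']
        omega
      · intro l
        simp only [Program.run, Expr.eval, h15, h16', Memory.arr_setReg, Memory.arr_setCell,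
          if_true, Function.update_apply]
        by_cases hl : l.val = k
        · obtain rfl : l = ⟨k, hk⟩ := Fin.ext hl
          rw [if_pos rfl, if_pos (by simp), hk', hav, Finset.card_filter, Finset.card_filter,
            Finset.sum_range_succ]
          congr 1
          split_ifs <;> simp_all
        · rw [if_neg hl, h' l]
          have : l.val < k + 1 ↔ l.val < k := by omega
          simp only [this]
    · intro σ₄ _ h' l
      rw [Memory.arr_setReg, h', if_pos l.2]

theorem computeWeights_meets (hW : Wide n m Γ f.delay W) (hG : StoresGraph link A σ)
    (hI : StoresInput m Γ f σ) {i : ℕ} (h13 : σ.reg 13 = f.packetArrival i)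
    (hg : f.packetArrival i + Γ < W) :
    Meets W computeWeights σ (f.delay % Γ * (19 * m + 22) + 38 * m + 18)
      (fun σ' => ∀ l : Fin m, σ'.arr 11 l = linkWeight f i A (link l).1 (link l).2) := by
  have hb := hW.basic
  have hd := hW.dist
  have hrΓ : f.delay % Γ < Γ := Nat.mod_lt _ (NeZero.pos Γ)
  have hrρ : f.delay % Γ ≤ f.delay := Nat.mod_le _ _
  refine Meets.mono (T := _ + (m * (19 + 8) + 6)) (Q := fun σ' =>
    ∀ l : Fin m, σ'.arr 11 l = linkWeight f i A (link l).1 (link l).2)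
    (Meets.seq (countOccupied_meets hW hG hI h13 hg) ?_) ?_ (fun _ _ h => h)
  · intro σ₁ ha h
    have hG₁ := hG.agree ha (by decide) (by decide)
    have hI₁ := hI.agree ha (by decide)
    -- Array 11 is overwritten in place: links below `k` hold weights, the others still hold the
    -- counts that their weights will be computed from.
    refine (Meets.forLoop (N := m) (fun k σ' => (∀ l : Fin m, l.val < k →
      σ'.arr 11 l = linkWeight f i A (link l).1 (link l).2) ∧
      ∀ l : Fin m, k ≤ l.val → σ'.arr 11 l = σ₁.arr 11 l)
      (by decide) (by decide) (by decide) hG₁.links (by omega) (by simp [Memory.arr_setReg])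
      ?_).mono le_rfl (fun σ' _ h l => h.1 l l.2)
    intro k σ₂ hk ha₂ h15 h'
    have hG₂ := hG₁.agree ha₂ (by decide) (by decide)
    have hI₂ := hI₁.agree ha₂ (by decide)
    have hc := (h'.2 ⟨k, hk⟩ le_rfl).trans (h ⟨k, hk⟩)
    have ho := hG₂.occupied ⟨k, hk⟩
    have hoΓ : (occupiedSlots A (link ⟨k, hk⟩).1 (link ⟨k, hk⟩).2).card ≤ Γ := by
      simpa [ZMod.card] using Finset.card_le_univ (occupiedSlots A _ _)
    have hcr : ((Finset.range (f.delay % Γ)).filter fun j => slotEdge (link ⟨k, hk⟩).1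
        (link ⟨k, hk⟩).2 ((f.packetArrival i + j : ℕ) : ZMod Γ) ∉ A).card ≤ f.delay :=
      (Finset.card_filter_le _ _).trans (by simpa using hrρ)
    have h₁ := Nat.mul_le_mul_right f.delay hoΓ
    have h₂ := Nat.mul_le_mul_left Γ hcr
    have h₃ : 2 * (Γ * f.delay) ≤ W := by nlinarith
    rw [mul_comm Γ (Finset.card _)] at h₂
    have hw : linkWeight f i A (link ⟨k, hk⟩).1 (link ⟨k, hk⟩).2 = if f.delay < Γ then
      σ₂.arr 3 k * f.delay + σ₂.arr 11 k * Γ else σ₂.arr 3 k * f.delay * 2 := by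
      simp only at ho hc
      rw [linkWeight, ho, hc]
    simp only at hc ho
    have : ∀ v : ℕ, (v = linkWeight f i A (link ⟨k, hk⟩).1 (link ⟨k, hk⟩).2) →
        (∀ l : Fin m, l.val < k + 1 → Function.update (σ₂.arr 11) k v l =
          linkWeight f i A (link l).1 (link l).2) ∧
        ∀ l : Fin m, k + 1 ≤ l.val → Function.update (σ₂.arr 11) k v l = σ₁.arr 11 l := by
      rintro v rfl
      refine ⟨fun l hl => ?_, fun l hl => ?_⟩
      · by_cases hlk : l.val = k
        · obtain rfl : l = ⟨k, hk⟩ := Fin.ext hlk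
          simp
        · rw [Function.update_of_ne hlk, h'.1 l (by omega)]
      · rw [Function.update_of_ne (by omega), h'.2 l (by omega)]
    by_cases hρΓ : f.delay < Γ
    · rw [if_pos hρΓ] at hw
      refine Program.Safe.meets ?_ (by decide) ?_
      · simp only [Program.Safe, Expr.Fits, Expr.eval, h15, hI₂.delay, hI₂.slots, hρΓ, if_true,
          one_ne_zero, if_false, ho, hc]
        omega
      · simp only [Program.run, Expr.eval, h15, hI₂.delay, hI₂.slots, hρΓ, if_true,
          one_ne_zero, if_false, Memory.arr_setReg, Memory.arr_setCell]
        exact this _ hw.symm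
    · rw [if_neg hρΓ] at hw
      refine Program.Safe.meets ?_ (by decide) ?_
      · simp only [Program.Safe, Expr.Fits, Expr.eval, h15, hI₂.delay, hI₂.slots, hρΓ, if_true,
          if_false, ho]
        omega
      · simp only [Program.run, Expr.eval, h15, hI₂.delay, hI₂.slots, hρΓ, if_true,
          if_false, Memory.arr_setReg, Memory.arr_setCell]
        exact this _ hw.symm
  · ring_nf; omega

end

/-- Improve the distance of the tail of the link at hand. -/
def relaxLink : Program :=
  .ite (.cell 2 (.add (.reg 16) (.reg 15)))
    (.seq (.assign 20 (.cell 9 (.add (.reg 18) (.cell 1 (.reg 15)))))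
      (.ite (.reg 20)
        (.seq (.assign 20 (.add (.reg 20) (.cell 11 (.reg 15))))
          (.seq (.assign 21 (.add (.reg 17) (.cell 0 (.reg 15))))
            (.seq (.assign 22 (.cell 9 (.reg 21)))
              (.ite (.add (.eq (.reg 22) (.const 0)) (.lt (.reg 20) (.reg 22)))
                (.seq (.store 9 (.reg 21) (.reg 20)) (.store 10 (.reg 21) (.reg 15)))
                .skip))))
        .skip))
    .skip

/-- Move to the slot before those treated so far, and compute the rows of the tables. -/
def loadLayerRows : Program :=
  .seq (.assign 14 (.sub (.sub (.reg 10) (.const 1)) (.reg 23)))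
    (.seq loadSlotRow
      (.seq (.assign 17 (.mul (.reg 14) (.reg 0))) (.assign 18 (.add (.reg 17) (.reg 0)))))

/-- Initially, only storage edges are used in the slot at hand. -/
def initLayer : Program :=
  .forLoop 15 0 (.seq (.store 9 (.add (.reg 17) (.reg 15)) (.cell 9 (.add (.reg 18) (.reg 15))))
    (.store 10 (.add (.reg 17) (.reg 15)) (.reg 1)))

/-- Compute the distances from the nodes of one slot. -/
def computeLayer : Program :=
  .seq loadLayerRows (.seq initLayer (.forLoop 15 1 relaxLink))

/-- Compute the distances from the nodes of all slots. -/
def computeTable : Program :=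
  .seq (.assign 17 (.mul (.reg 10) (.reg 0)))
    (.seq (.forLoop 15 0 (.store 9 (.add (.reg 17) (.reg 15)) (.eq (.reg 15) (.reg 4))))
      (.forLoop 23 10 computeLayer))

/-! ### Correctness of the distance tables -/

section

variable {n m Γ : ℕ} {link : Fin m → Fin n × Fin n} {A : Finset (Edge (Fin n) Γ)}
  {f : Flow (Fin n)} {W : ℕ} {σ : Memory}

theorem update_add (F : ℕ → ℕ) (b u v : ℕ) :
    (fun x => Function.update F (b + u) v (b + x)) =
      Function.update (fun x => F (b + x)) u v := by
  funext x
  simp [Function.update_apply]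

/-- The current row occupies the cells from `b` on and the next row those from `b + n` on, so
writing at the tail of a link leaves all later rows intact. `B` and `M` bound distances and weights,
which excludes overflow. -/
theorem relaxLink_meets {t : ZMod Γ} {D' : ℕ → ℕ} {w : Fin m → ℕ} {l : Fin m} {a b B M : ℕ}
    (h15 : σ.reg 15 = l) (h16 : σ.reg 16 = a) (h17 : σ.reg 17 = b) (h18 : σ.reg 18 = b + n)
    (htail : σ.arr 0 l = (link l).1) (hhead : σ.arr 1 l = (link l).2)
    (havail : σ.arr 2 (a + l) = if slotEdge (link l).1 (link l).2 t ∈ A then 1 else 0)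
    (hweight : σ.arr 11 l = w l) (hD' : ∀ u : Fin n, σ.arr 9 (b + n + u) = D' u)
    (hL : IsLayer link A t w l (fun u => σ.arr 9 (b + u)) D' (fun u => σ.arr 10 (b + u)))
    (ha : a + m ≤ W) (hb : b + n + n ≤ W) (hnm : n + m + 2 ≤ W) (hB : ∀ u : Fin n, D' u ≤ B)
    (hM : ∀ l, w l ≤ M) (hW : B + M ≤ W) :
    Meets W relaxLink σ 50 (fun σ' =>
      IsLayer link A t w (l + 1) (fun u => σ'.arr 9 (b + u)) D' (fun u => σ'.arr 10 (b + u)) ∧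
      ∀ x, b + n ≤ x → σ'.arr 9 x = σ.arr 9 x ∧ σ'.arr 10 x = σ.arr 10 x) := by
  have hl := l.2
  have hu := (link l).1.2
  have hv := (link l).2.2
  have hDv := hD' (link l).2
  have hDu := hL.le hM hB (link l).1
  have hBv := hB (link l).2
  have hMl := hM l
  by_cases he : slotEdge (link l).1 (link l).2 t ∈ A
  · rw [if_pos he] at havail
    by_cases h₀ : D' (link l).2 = 0
    · rw [h₀] at hDv
      refine Program.Safe.meets ?_ (by decide) ?_
      · simp [relaxLink, Program.Safe, Program.run, Expr.Fits, Expr.eval, Memory.reg_setReg,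
          h15, h16, h18, havail, hhead, hDv]
        omega
      · simp [relaxLink, Program.run, Expr.eval, Memory.reg_setReg,
          Memory.arr_setReg, h15, h16, h18, havail, hhead, hDv]
        exact hL.skip fun _ h => absurd h₀ h
    · by_cases h₁ : σ.arr 9 (b + (link l).1) = 0 ∨ D' (link l).2 + w l < σ.arr 9 (b + (link l).1)
      · have hc : ((if σ.arr 9 (b + (link l).1) = 0 then 1 else 0) +
          if D' (link l).2 + w l < σ.arr 9 (b + (link l).1) then 1 else 0) ≠ 0 := by
          rcases h₁ with h₁ | h₁ <;> simp [h₁]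
        refine Program.Safe.meets ?_ (by decide) ?_
        · simp only [relaxLink, Program.Safe, Program.run, Expr.Fits, Expr.eval,
            Memory.reg_setReg, Memory.arr_setReg, h15, h16, h17, h18, havail, hhead, htail, hDv,
            hweight, Memory.reg_setCell, Nat.reduceEqDiff, if_true, if_false,
            one_ne_zero, h₀, hc]
          split_ifs <;> omega
        · simp only [relaxLink, Program.run, Expr.eval,
            Memory.reg_setReg, Memory.arr_setReg, h15, h16, h17, h18, havail, hhead, htail, hDv,
            hweight, Memory.arr_setCell, Memory.reg_setCell, Nat.reduceEqDiff, if_true, if_false,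
            one_ne_zero, h₀, hc, update_add]
          refine ⟨hL.update he h₀ h₁, fun x hx => ?_⟩
          rw [Function.update_of_ne (by omega), Function.update_of_ne (by omega)]
          exact ⟨rfl, rfl⟩
      · have hc : ((if σ.arr 9 (b + (link l).1) = 0 then 1 else 0) +
          if D' (link l).2 + w l < σ.arr 9 (b + (link l).1) then 1 else 0) = 0 := by
          rw [not_or] at h₁
          simp [h₁.1, h₁.2]
        refine Program.Safe.meets ?_ (by decide) ?_
        · simp only [relaxLink, Program.Safe, Program.run, Expr.Fits, Expr.eval,
            Memory.reg_setReg, Memory.arr_setReg, h15, h16, h17, h18, havail, hhead, htail, hDv,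
            hweight, Nat.reduceEqDiff, if_true, if_false, one_ne_zero, h₀, hc, eq_self, and_true]
          omega
        · simp only [relaxLink, Program.run, Expr.eval,
            Memory.reg_setReg, Memory.arr_setReg, h15, h16, h17, h18, havail, hhead, htail, hDv,
            hweight, Nat.reduceEqDiff, if_true, if_false, one_ne_zero, h₀, hc, eq_self]
          exact ⟨hL.skip fun _ _ => by omega, fun _ _ => ⟨trivial, trivial⟩⟩
  · rw [if_neg he] at havail
    refine Program.Safe.meets ?_ (by decide) ?_
    · simp [relaxLink, Program.Safe, Expr.Fits, Expr.eval, h15, h16, havail]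
      omega
    · simp [relaxLink, Program.run, Expr.eval, h15, h16, havail]
      exact hL.skip fun h => absurd h he

theorem initLayer_meets {t : ZMod Γ} {D' : ℕ → ℕ} {w : Fin m → ℕ} {b : ℕ}
    (h0 : σ.reg 0 = n) (h1 : σ.reg 1 = m) (h17 : σ.reg 17 = b) (h18 : σ.reg 18 = b + n)
    (hD' : ∀ u : Fin n, σ.arr 9 (b + n + u) = D' u)
    (hb : b + n + n ≤ W) (hnm : n + m + 2 ≤ W) (hB : ∀ u : Fin n, D' u ≤ W) :
    Meets W initLayer σ (n * (20 + 8) + 6) (fun σ' =>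
      IsLayer link A t w 0 (fun u => σ'.arr 9 (b + u)) D' (fun u => σ'.arr 10 (b + u)) ∧
      ∀ x, b + n ≤ x → σ'.arr 9 x = σ.arr 9 x ∧ σ'.arr 10 x = σ.arr 10 x) := by
  refine (Meets.forLoop (N := n) (fun k σ' => (∀ u : Fin n, u.val < k →
      σ'.arr 9 (b + u) = D' u ∧ σ'.arr 10 (b + u) = m) ∧
      ∀ x, b + n ≤ x → σ'.arr 9 x = σ.arr 9 x ∧ σ'.arr 10 x = σ.arr 10 x)
      (by decide) (by decide) (by decide) h0 (by omega) (by simp [Memory.arr_setReg]) ?_).mono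
      le_rfl (fun σ' _ h => ⟨.init (fun u => (h.1 u u.2).1) (fun u => (h.1 u u.2).2), h.2⟩)
  intro k σ₁ hk ha h15 h
  have h17' : σ₁.reg 17 = b := by rw [ha.reg _ (by decide), h17]
  have h18' : σ₁.reg 18 = b + n := by rw [ha.reg _ (by decide), h18]
  have h1' : σ₁.reg 1 = m := by rw [ha.reg _ (by decide), h1]
  have hv := (h.2 (b + n + k) (by omega)).1.trans (hD' ⟨k, hk⟩)
  have hvW := hB ⟨k, hk⟩
  simp only at hv hvW
  refine Program.Safe.meets ?_ (by decide) ?_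
  · simp only [Program.Safe, Program.run, Expr.Fits, Expr.eval, Memory.reg_setCell, h15, h17', h18',
      h1', hv]
    omega
  · simp only [Program.run, Expr.eval, Memory.reg_setCell, Memory.arr_setCell, h15, h17', h18',
      h1', hv, Memory.arr_setReg, Nat.reduceEqDiff, if_true, if_false, Function.update_apply,
      add_right_inj]
    refine ⟨fun u hu => ?_, fun x hx => ?_⟩
    · by_cases huk : u.val = k
      · obtain rfl : u = ⟨k, hk⟩ := Fin.ext huk
        simp
      · rw [if_neg huk, if_neg huk]
        exact h.1 u (by omega)
    · rw [if_neg (by omega), if_neg (by omega)]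
      exact h.2 x hx

/-- Rows `j` and `j + 1` are both addressed while layer `j` is computed. -/
theorem Wide.tableRow {ρ : ℕ} (hW : Wide n m Γ ρ W) {j : ℕ} (hj : j < Γ) : j * n + n + n ≤ W :=
  calc j * n + n + n = (j + 2) * n := by ring
    _ ≤ (Γ + 1) * n := Nat.mul_le_mul_right _ (by omega)
    _ ≤ W := hW.rows

variable [NeZero Γ]

theorem loadLayerRows_meets (hW : Wide n m Γ f.delay W) (hI : StoresInput m Γ f σ) {g J : ℕ}
    (hg : g + Γ < W) (h13 : σ.reg 13 = g) (h23 : σ.reg 23 = J) (hJ : J < f.delay % Γ) :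
    Meets W loadLayerRows σ 25 (fun σ' =>
      σ'.reg 16 = (g + (f.delay % Γ - 1 - J)) % Γ * m ∧
      σ'.reg 17 = (f.delay % Γ - 1 - J) * n ∧ σ'.reg 18 = (f.delay % Γ - 1 - J) * n + n) := by
  have hb := hW.basic
  have hrΓ : f.delay % Γ < Γ := Nat.mod_lt _ (NeZero.pos Γ)
  have hrow := hW.tableRow (j := f.delay % Γ - 1 - J) (by omega)
  have hrow' := hW.slotRow (g + (f.delay % Γ - 1 - J))
  have hmod := Nat.mod_lt (g + (f.delay % Γ - 1 - J)) (NeZero.pos Γ)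
  refine Program.Safe.meets ?_ (by decide) ?_
  · simp only [loadLayerRows, loadSlotRow, Program.Safe, Program.run, Expr.Fits, Expr.eval,
      Memory.reg_setReg, hI.depth, hI.slots, hI.nodes, hI.links, h13, h23, Nat.reduceEqDiff,
      if_true, if_false]
    omega
  · simp [loadLayerRows, loadSlotRow, Program.run, Expr.eval, Memory.reg_setReg, hI.depth,
      hI.slots, hI.nodes, hI.links, h13, h23]

theorem computeLayer_meets (hW : Wide n m Γ f.delay W) (hG : StoresGraph link A σ)
    (hI : StoresInput m Γ f σ) {g J B M : ℕ} (hg : g + Γ < W) (h13 : σ.reg 13 = g)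
    (h23 : σ.reg 23 = J) (hJ : J < f.delay % Γ) {w : Fin m → ℕ} (hw : ∀ l : Fin m, σ.arr 11 l = w l)
    (hB : ∀ u : Fin n, σ.arr 9 ((f.delay % Γ - 1 - J) * n + n + u) ≤ B) (hM : ∀ l, w l ≤ M)
    (hBM : B + M ≤ W) :
    Meets W computeLayer σ (28 * n + 58 * m + 37) (fun σ' =>
      IsLayer link A ((g + (f.delay % Γ - 1 - J) : ℕ) : ZMod Γ) w m
        (fun u => σ'.arr 9 ((f.delay % Γ - 1 - J) * n + u))
        (fun u => σ.arr 9 ((f.delay % Γ - 1 - J) * n + n + u))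
        (fun u => σ'.arr 10 ((f.delay % Γ - 1 - J) * n + u)) ∧
      ∀ x, (f.delay % Γ - 1 - J) * n + n ≤ x →
        σ'.arr 9 x = σ.arr 9 x ∧ σ'.arr 10 x = σ.arr 10 x) := by
  have hb := hW.basic
  have hrΓ : f.delay % Γ < Γ := Nat.mod_lt _ (NeZero.pos Γ)
  refine Meets.mono (T := 25 + ((n * (20 + 8) + 6) + (m * (50 + 8) + 6))) (Q := fun σ' => _)
    (Meets.seq (loadLayerRows_meets hW hI hg h13 h23 hJ) ?_) (by ring_nf; omega) (fun _ _ h => h)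
  generalize hj : f.delay % Γ - 1 - J = j at hB ⊢
  have hrow := hW.tableRow (j := j) (by omega)
  have hrow' := hW.slotRow (g + j)
  rintro σ₁ ha ⟨h16, h17, h18⟩
  have hG₁ := hG.agree ha (by decide) (by decide)
  have hI₁ := hI.agree ha (by decide)
  have e9 : σ₁.arr 9 = σ.arr 9 := ha.arr _ (by decide)
  have e10 : σ₁.arr 10 = σ.arr 10 := ha.arr _ (by decide)
  have e11 : σ₁.arr 11 = σ.arr 11 := ha.arr _ (by decide)
  refine Meets.seq (initLayer_meets (link := link) (A := A) (t := ((g + j : ℕ) : ZMod Γ)) (w := w)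
    hI₁.nodes hI₁.links h17 h18 (D' := fun u => σ.arr 9 (j * n + n + u)) (by simp [e9]) hrow
    (by omega) (fun u => (hB u).trans (by omega))) ?_
  rintro σ₂ ha₂ ⟨hL, hf⟩
  have hG₂ := hG₁.agree ha₂ (by decide) (by decide)
  refine (Meets.forLoop (N := m) (fun k σ' =>
      IsLayer link A ((g + j : ℕ) : ZMod Γ) w k (fun u => σ'.arr 9 (j * n + u))
        (fun u => σ.arr 9 (j * n + n + u)) (fun u => σ'.arr 10 (j * n + u)) ∧
      ∀ x, j * n + n ≤ x → σ'.arr 9 x = σ.arr 9 x ∧ σ'.arr 10 x = σ.arr 10 x)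
      (by decide) (by decide) (by decide) hG₂.links (by omega) ?_ ?_)
  · refine ⟨hL, fun x hx => ?_⟩
    rw [Memory.arr_setReg, ← e9, ← e10]
    exact hf x hx
  · rintro k σ₃ hk ha₃ h15 ⟨hL₃, hf₃⟩
    have hG₃ := hG₂.agree ha₃ (by decide) (by decide)
    have e11' : σ₃.arr 11 k = w ⟨k, hk⟩ := by
      rw [ha₃.arr _ (by decide), ha₂.arr _ (by decide), e11, ← hw]
    refine (relaxLink_meets (l := ⟨k, hk⟩) (a := (g + j) % Γ * m) (b := j * n) h15
      (by rw [ha₃.reg _ (by decide), ha₂.reg _ (by decide), h16])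
      (by rw [ha₃.reg _ (by decide), ha₂.reg _ (by decide), h17])
      (by rw [ha₃.reg _ (by decide), ha₂.reg _ (by decide), h18])
      (hG₃.tail _) (hG₃.head _) (hG₃.avail_natCast _ _) e11'
      (fun u => (hf₃ _ (by omega)).1) hL₃ hrow' hrow (by omega) hB hM hBM).mono le_rfl ?_
    rintro σ₄ - ⟨hL₄, hf₄⟩
    refine ⟨hL₄, fun x hx => ?_⟩
    rw [Memory.arr_setReg, (hf₄ x hx).1, (hf₄ x hx).2]
    exact hf₃ x hx

theorem computeTable_meets (hW : Wide n m Γ f.delay W) (hG : StoresGraph link A σ)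
    (hI : StoresInput m Γ f σ) {i : ℕ} (hg : f.packetArrival i + Γ < W)
    (h13 : σ.reg 13 = f.packetArrival i)
    (hw : ∀ l : Fin m, σ.arr 11 l = linkWeight f i A (link l).1 (link l).2) :
    Meets W computeTable σ (f.delay % Γ * (28 * n + 58 * m + 45) + 15 * n + 16)
      (fun σ' => IsTable link A f i (fun j u => σ'.arr 9 (j * n + u))
        (fun j u => σ'.arr 10 (j * n + u)) ∧ ∀ u : Fin n, σ'.arr 9 u ≤ W) := by
  have hb := hW.basic
  have hdist := hW.dist
  have hrΓ : f.delay % Γ < Γ := Nat.mod_lt _ (NeZero.pos Γ)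
  refine Meets.mono (T := 4 + ((n * (7 + 8) + 6) + (f.delay % Γ * (28 * n + 58 * m + 37 + 8) + 6)))
    (Meets.seq (Q₁ := fun σ' => σ'.reg 17 = f.delay % Γ * n) ?_ ?_)
    (by ring_nf; omega) (fun _ _ h => h)
  · have := hW.tableRow hrΓ
    refine Program.Safe.meets ?_ (by decide) ?_
    · simp only [Program.Safe, Expr.Fits, Expr.eval, hI.depth, hI.nodes]; omega
    · simp [Program.run, Expr.eval, hI.depth, hI.nodes, Memory.reg_setReg]
  intro σ₁ ha h17
  have hG₁ := hG.agree ha (by decide) (by decide)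
  have hI₁ := hI.agree ha (by decide)
  have hd := f.target.2
  refine Meets.seq (Q₁ := fun σ' => ∀ u : Fin n, σ'.arr 9 (f.delay % Γ * n + u) =
    if u = f.target then 1 else 0) ?_ ?_
  · have := hW.tableRow hrΓ
    refine (Meets.forLoop (N := n) (fun k σ' => ∀ u : Fin n, u.val < k →
      σ'.arr 9 (f.delay % Γ * n + u) = if u = f.target then 1 else 0)
      (by decide) (by decide) (by decide) hI₁.nodes (by omega) (by simp) ?_).mono le_rfl
      (fun σ' _ h u => h u u.2)
    intro k σ₂ hk ha₂ h15 h
    have h17' : σ₂.reg 17 = f.delay % Γ * n := by rw [ha₂.reg _ (by decide), h17]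
    have hI₂ := hI₁.agree ha₂ (by decide)
    refine Program.Safe.meets ?_ (by decide) ?_
    · simp only [Program.Safe, Expr.Fits, Expr.eval, h15, h17', hI₂.target]
      omega
    · intro u hu
      simp only [Program.run, Expr.eval, h15, h17', hI₂.target, Memory.arr_setReg,
        Memory.arr_setCell, if_true, Function.update_apply, add_right_inj]
      by_cases huk : u.val = k
      · rw [if_pos huk, ← huk]
        simp only [Fin.ext_iff]
      · rw [if_neg huk]
        exact h u (by omega)
  intro σ₂ ha₂ h₀
  have hG₂ := hG₁.agree ha₂ (by decide) (by decide)
  have hI₂ := hI₁.agree ha₂ (by decide)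
  set r := f.delay % Γ with hr
  have hw₂ : ∀ l : Fin m, σ₂.arr 11 l = linkWeight f i A (link l).1 (link l).2 := fun l => by
    rw [ha₂.arr _ (by decide), ha.arr _ (by decide), hw]
  have hM : ∀ l : Fin m, linkWeight f i A (link l).1 (link l).2 ≤ 2 * (Γ * f.delay) :=
    fun l => linkWeight_le _ _ _ _ _
  generalize 2 * (Γ * f.delay) = M at hM hdist
  -- Each layer raises the distances by at most `M`, starting from the shifted value 1 in the last
  -- layer.
  have hd' : ∀ k, k ≤ Γ + 1 → 1 + k * M ≤ W := fun k hk => by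
    have := Nat.mul_le_mul_right M hk
    omega
  -- The counter `J` runs upwards while the layers are filled downwards: after `J` rounds, layers `r
  -- - J` to `r - 1` are correct and row `r - J` is bounded by `1 + J * M`.
  refine (Meets.forLoop (N := r) (fun J σ' =>
      (∀ u : Fin n, σ'.arr 9 (r * n + u) = if u = f.target then 1 else 0) ∧
      (∀ j, r - J ≤ j → j < r → IsLayer link A ((f.packetArrival i + j : ℕ) : ZMod Γ)
        (fun l => linkWeight f i A (link l).1 (link l).2) m (fun u => σ'.arr 9 (j * n + u))
        (fun u => σ'.arr 9 ((j + 1) * n + u)) (fun u => σ'.arr 10 (j * n + u))) ∧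
      ∀ u : Fin n, σ'.arr 9 ((r - J) * n + u) ≤ 1 + J * M)
      (by decide) (by decide) (by decide) hI₂.depth (by omega) ?_ ?_).mono le_rfl ?_
  · refine ⟨h₀, fun j hj hj' => by omega, fun u => ?_⟩
    rw [Memory.arr_setReg, Nat.sub_zero, h₀]
    split_ifs <;> omega
  · rintro J σ₃ hJ ha₃ h23 ⟨hlast, hlayer, hB⟩
    have hG₃ := hG₂.agree ha₃ (by decide) (by decide)
    have hI₃ := hI₂.agree ha₃ (by decide)
    have hj : r - 1 - J + 1 = r - J := by omega
    have hj' : (r - 1 - J) * n + n = (r - J) * n := by rw [← hj]; ring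
    refine (computeLayer_meets hW hG₃ hI₃ hg (B := 1 + J * M) (M := M)
      (by rw [ha₃.reg _ (by decide), ha₂.reg _ (by decide), ha.reg _ (by decide), h13]) h23 hJ
      (fun l => by rw [ha₃.arr _ (by decide), hw₂ l]) (by rw [← hr, hj']; exact hB) hM
      (by have := hd' (J + 1) (by omega); rw [add_mul] at this; omega)).mono le_rfl ?_
    rintro σ₄ - ⟨hL, hf⟩
    rw [← hr] at hL hf
    simp only [hj'] at hL hf
    have hrow : ∀ j x, r - J ≤ j → σ₄.arr 9 (j * n + x) = σ₃.arr 9 (j * n + x) ∧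
        σ₄.arr 10 (j * n + x) = σ₃.arr 10 (j * n + x) := fun j x hj => hf _ (by
      have := Nat.mul_le_mul_right n hj; omega)
    simp only [Memory.arr_setReg]
    refine ⟨fun u => ?_, fun j hj₁ hj₂ => ?_, fun u => ?_⟩
    · rw [(hrow r u (by omega)).1, hlast]
    · by_cases hjJ : r - J ≤ j
      · have h₁ := fun x => (hrow j x hjJ).1
        have h₂ := fun x => (hrow j x hjJ).2
        have h₃ := fun x => (hrow (j + 1) x (by omega)).1
        simp only [h₁, h₂, h₃]
        exact hlayer j hjJ hj₂
      · obtain rfl : j = r - 1 - J := by omega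
        have h₃ := fun x => (hrow (r - J) x le_rfl).1
        simp only [hj, h₃]
        exact hL
    · rw [show r - (J + 1) = r - 1 - J by omega]
      have := hL.le hM hB u
      rw [add_mul]; omega
  · rintro σ₃ - ⟨h₁, h₂, h₃⟩
    refine ⟨⟨h₁, fun j hj => h₂ j (by omega) hj⟩, fun u => ?_⟩
    have h := h₃ u
    simp only [Nat.sub_self, Nat.zero_mul, Nat.zero_add] at h
    exact h.trans (hd' r (by omega))

end

/-- Follow the table of links from the source, record the path, and remove its communication
edges. -/
def recordEdge : Program :=
  .seq (.assign 20 (.mod (.add (.reg 13) (.reg 14)) (.reg 2)))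
    (.seq (.assign 21 (.cell 10 (.add (.mul (.reg 14) (.reg 0)) (.reg 19))))
    (.seq (.assign 22 (.add (.reg 17) (.reg 14)))
    (.seq (.store 4 (.reg 22) (.reg 19))
    (.seq (.store 6 (.reg 22) (.reg 20))
    (.seq (.store 8 (.reg 22) (.reg 21))
    (.seq (.ite (.lt (.reg 21) (.reg 1))
      (.seq (.assign 19 (.cell 1 (.reg 21)))
        (.seq (.store 2 (.add (.mul (.reg 20) (.reg 1)) (.reg 21)) (.const 0))
          (.store 3 (.reg 21) (.add (.cell 3 (.reg 21)) (.const 1)))))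
      .skip)
    (.store 5 (.reg 22) (.reg 19))))))))

/-- Record the path of the packet at hand. -/
def recordPath : Program :=
  .seq (.seq (.assign 19 (.reg 3)) (.assign 17 (.mul (.reg 12) (.reg 7))))
    (.seq (.forLoop 14 10 recordEdge)
      (.seq (.store 7 (.reg 12) (.reg 10)) (.assign 8 (.add (.reg 12) (.const 1)))))

/-- Restore an edge of a recorded path. -/
def restoreEdge : Program :=
  .seq (.assign 20 (.cell 8 (.add (.reg 17) (.reg 14))))
    (.ite (.lt (.reg 20) (.reg 1))
      (.seq (.assign 21 (.add (.mul (.cell 6 (.add (.reg 17) (.reg 14))) (.reg 1)) (.reg 20)))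
        (.ite (.cell 2 (.reg 21)) .skip
          (.seq (.store 2 (.reg 21) (.const 1))
            (.store 3 (.reg 20) (.sub (.cell 3 (.reg 20)) (.const 1))))))
      .skip)

/-- Restore the edges of all recorded paths, and discard the paths. -/
def restorePaths : Program :=
  .seq (.assign 23 (.reg 8))
    (.seq (.forLoop 12 23 (.seq (.assign 17 (.mul (.reg 12) (.reg 7))) (.forLoop 14 10 restoreEdge)))
      (.assign 8 (.const 0)))

/-! ### Recording and restoring paths -/

section

variable {n m Γ : ℕ} {link : Fin m → Fin n × Fin n} {A : Finset (Edge (Fin n) Γ)}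
  {f : Flow (Fin n)} {W : ℕ} {σ : Memory}

theorem slotEdge_inj {V : Type*} {u v u' v' : V} {t t' : ZMod Γ} :
    slotEdge u v t = slotEdge u' v' t' ↔ u = u' ∧ v = v' ∧ t = t' := by
  simp only [slotEdge, Prod.mk.injEq]
  constructor
  · rintro ⟨⟨h₁, h₂⟩, h₃, -⟩; exact ⟨h₁, h₃, h₂⟩
  · rintro ⟨rfl, rfl, rfl⟩; simp

theorem index_inj {a b k l : ℕ} (hk : k < m) (hl : l < m) (h : a * m + k = b * m + l) :
    a = b ∧ k = l := by
  have h₁ : k = l := by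
    have := congrArg (· % m) h
    simpa [Nat.add_comm, Nat.add_mul_mod_self_right, Nat.mod_eq_of_lt hk,
      Nat.mod_eq_of_lt hl] using this
  subst h₁
  exact ⟨Nat.eq_of_mul_eq_mul_right (by omega) (Nat.add_right_cancel h), rfl⟩

theorem link_slotEdge_inj (hinj : Function.Injective link) {l l' : Fin m} {t t' : ZMod Γ} :
    slotEdge (link l').1 (link l').2 t' = slotEdge (link l).1 (link l).2 t ↔ l' = l ∧ t' = t := by
  rw [slotEdge_inj, ← hinj.eq_iff, Prod.ext_iff, and_assoc]

/-- The cells with index `x` hold the edge `e`, and the number of its link (`m` for a storage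
edge). -/
structure StoresEdge (link : Fin m → Fin n × Fin n) (σ : Memory) (x : ℕ)
    (e : Edge (Fin n) Γ) : Prop where
  tail : σ.arr 4 x = e.1.1
  head : σ.arr 5 x = e.2.1
  slot : σ.arr 6 x = e.1.2.val
  number : σ.arr 8 x = m ∧ e = slotEdge e.1.1 e.1.1 e.1.2 ∨
    ∃ l : Fin m, σ.arr 8 x = l ∧ e = slotEdge (link l).1 (link l).2 e.1.2

theorem StoresEdge.congr {σ' : Memory} {x : ℕ} {e : Edge (Fin n) Γ} (h : StoresEdge link σ x e)
    (ha : ∀ a ∈ [4, 5, 6, 8], σ'.arr a x = σ.arr a x) : StoresEdge link σ' x e := by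
  constructor
  · rw [ha _ (by simp), h.tail]
  · rw [ha _ (by simp), h.head]
  · rw [ha _ (by simp), h.slot]
  · rw [ha _ (by simp)]; exact h.number

/-- The memory holds the list `P` of schedule paths with `r` edges each, and the numbers of the
links of their edges. -/
structure StoresRoutes (link : Fin m → Fin n × Fin n) (r ρ : ℕ) (P : List (List (Edge (Fin n) Γ)))
    (σ : Memory) : Prop where
  count : σ.reg 8 = P.length
  length : ∀ (k : ℕ) (hk : k < P.length), σ.arr 7 k = r ∧ P[k].length = r
  edge : ∀ (k j : ℕ) (hk : k < P.length) (hj : j < P[k].length),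
    StoresEdge link σ (k * ρ + j) P[k][j]

theorem StoresRoutes.storesPaths {r ρ : ℕ} {P : List (List (Edge (Fin n) Γ))} (hr : r ≤ ρ)
    (h : StoresRoutes link r ρ P σ) : StoresPaths ρ P σ :=
  ⟨h.count, fun k hk => ⟨by rw [(h.length k hk).1, (h.length k hk).2],
    (h.length k hk).2.trans_le hr⟩, fun k j hk hj => (h.edge k j hk hj).tail,
    fun k j hk hj => (h.edge k j hk hj).head, fun k j hk hj => (h.edge k j hk hj).slot⟩

theorem StoresRoutes.agree {r ρ : ℕ} {P : List (List (Edge (Fin n) Γ))} {σ' : Memory}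
    {R S : List ℕ} (h : StoresRoutes link r ρ P σ) (ha : Memory.Agree R S σ σ') (hR : 8 ∉ R)
    (hS : ∀ a ∈ [4, 5, 6, 7, 8], a ∉ S) : StoresRoutes link r ρ P σ' := by
  refine ⟨by rw [ha.reg _ hR, h.count], fun k hk => ?_, fun k j hk hj => ?_⟩
  · rw [ha.arr _ (hS _ (by simp))]; exact h.length k hk
  · refine (h.edge k j hk hj).congr fun a ha' => ?_
    rw [ha.arr _ (hS _ (by revert ha'; simp; tauto))]

/-- Lets the path be removed edge by edge while it is being traced, with storage edges left in
place. -/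
theorem sdiff_range'_succ (A : Finset (Edge (Fin n) Γ)) (e : ℕ → Edge (Fin n) Γ) (J : ℕ) :
    A \ ((List.range' 0 (J + 1)).map e).toFinset.filter IsComm =
      if IsComm (e J) then (A \ ((List.range' 0 J).map e).toFinset.filter IsComm).erase (e J)
      else A \ ((List.range' 0 J).map e).toFinset.filter IsComm := by
  have : ∀ x, x ∈ ((List.range' 0 (J + 1)).map e) ↔ x ∈ (List.range' 0 J).map e ∨ x = e J := by
    intro x
    rw [List.range'_1_concat]
    simp
  ext x
  split_ifs with h
  · simp only [Finset.mem_sdiff, Finset.mem_filter, List.mem_toFinset, this, Finset.mem_erase]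
    by_cases hx : x = e J
    · subst hx; simp [h]
    · simp [hx]
  · simp only [Finset.mem_sdiff, Finset.mem_filter, List.mem_toFinset, this]
    by_cases hx : x = e J
    · subst hx; simp [h]
    · simp [hx]

variable [NeZero Γ]

theorem occupiedSlots_le {V : Type*} [DecidableEq V] (A : Finset (Edge V Γ)) (u v : V) :
    (occupiedSlots A u v).card ≤ Γ := by
  simpa [ZMod.card] using Finset.card_le_univ (occupiedSlots A u v)

theorem slot_index_inj {l l' : Fin m} {t t' : ZMod Γ} :
    t'.val * m + l' = t.val * m + l ↔ l' = l ∧ t' = t := by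
  constructor
  · intro h
    obtain ⟨h₁, h₂⟩ := index_inj l'.2 l.2 h
    exact ⟨Fin.ext h₂, ZMod.val_injective Γ h₁⟩
  · rintro ⟨rfl, rfl⟩; rfl

/-- By injectivity of `link`, an edge belongs to a single link and slot, so its removal changes one
availability bit and one load label. The label grows by exactly one because the slot was free
before. -/
theorem StoresGraph.occupy (hG : StoresGraph link A σ) (hinj : Function.Injective link)
    {l : Fin m} {t : ZMod Γ} (he : slotEdge (link l).1 (link l).2 t ∈ A) {σ' : Memory}
    (hr : ∀ x ∈ [0, 1, 2], σ'.reg x = σ.reg x) (ha : ∀ a ∈ [0, 1], σ'.arr a = σ.arr a)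
    (h₂ : σ'.arr 2 = Function.update (σ.arr 2) (t.val * m + l) 0)
    (h₃ : σ'.arr 3 = Function.update (σ.arr 3) l (σ.arr 3 l + 1)) :
    StoresGraph link (A.erase (slotEdge (link l).1 (link l).2 t)) σ' := by
  refine ⟨?_, ?_, ?_, ?_, ?_, fun t' l' => ?_, fun l' => ?_⟩
  · rw [hr _ (by simp), hG.nodes]
  · rw [hr _ (by simp), hG.links]
  · rw [hr _ (by simp), hG.slots]
  · rw [ha _ (by simp)]; exact hG.tail
  · rw [ha _ (by simp)]; exact hG.head
  · rw [h₂, Function.update_apply]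
    simp only [Finset.mem_erase, Ne, link_slotEdge_inj hinj, slot_index_inj, hG.avail]
    by_cases h : l' = l ∧ t' = t <;> simp [h]
  · rw [h₃, Function.update_apply]
    by_cases h : l' = l
    · subst h
      rw [if_pos rfl, hG.occupied]
      have : occupiedSlots (A.erase (slotEdge (link l').1 (link l').2 t)) (link l').1 (link l').2 =
          insert t (occupiedSlots A (link l').1 (link l').2) := by
        ext t'
        simp only [occupiedSlots, Finset.mem_filter, Finset.mem_univ, true_and, Finset.mem_erase,
          Ne, slotEdge_inj, Finset.mem_insert]
        tauto
      rw [this, Finset.card_insert_of_notMem]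
      simpa [occupiedSlots] using he
    · rw [if_neg (by simpa [Fin.ext_iff] using h), hG.occupied]
      congr 1
      ext t'
      simp [occupiedSlots, link_slotEdge_inj hinj, h]

theorem StoresGraph.release (hG : StoresGraph link A σ) (hinj : Function.Injective link)
    {l : Fin m} {t : ZMod Γ} (he : slotEdge (link l).1 (link l).2 t ∉ A) {σ' : Memory}
    (hr : ∀ x ∈ [0, 1, 2], σ'.reg x = σ.reg x) (ha : ∀ a ∈ [0, 1], σ'.arr a = σ.arr a)
    (h₂ : σ'.arr 2 = Function.update (σ.arr 2) (t.val * m + l) 1)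
    (h₃ : σ'.arr 3 = Function.update (σ.arr 3) l (σ.arr 3 l - 1)) :
    StoresGraph link (insert (slotEdge (link l).1 (link l).2 t) A) σ' := by
  refine ⟨?_, ?_, ?_, ?_, ?_, fun t' l' => ?_, fun l' => ?_⟩
  · rw [hr _ (by simp), hG.nodes]
  · rw [hr _ (by simp), hG.links]
  · rw [hr _ (by simp), hG.slots]
  · rw [ha _ (by simp)]; exact hG.tail
  · rw [ha _ (by simp)]; exact hG.head
  · rw [h₂, Function.update_apply]
    simp only [Finset.mem_insert, link_slotEdge_inj hinj, slot_index_inj, hG.avail]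
    by_cases h : l' = l ∧ t' = t <;> simp [h]
  · rw [h₃, Function.update_apply]
    by_cases h : l' = l
    · subst h
      rw [if_pos rfl, hG.occupied]
      have : occupiedSlots (insert (slotEdge (link l').1 (link l').2 t) A) (link l').1 (link l').2 =
          (occupiedSlots A (link l').1 (link l').2).erase t := by
        ext t'
        simp only [occupiedSlots, Finset.mem_filter, Finset.mem_univ, true_and, Finset.mem_erase,
          Ne, slotEdge_inj, Finset.mem_insert]
        tauto
      rw [this, Finset.card_erase_of_mem]
      simpa [occupiedSlots] using he
    · rw [if_neg (by simpa [Fin.ext_iff] using h), hG.occupied]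
      congr 1
      ext t'
      simp [occupiedSlots, link_slotEdge_inj hinj, h]

theorem recordEdge_meets {B : Finset (Edge (Fin n) Γ)} (hW : Wide n m Γ f.delay W)
    (hinj : Function.Injective link) {g b J : ℕ} (hg : g + Γ < W) (hb : b + J ≤ W) (hJ : J < Γ)
    (hG : StoresGraph link B σ) (h13 : σ.reg 13 = g) (h14 : σ.reg 14 = J) (h17 : σ.reg 17 = b)
    {u v : Fin n} (h19 : σ.reg 19 = u)
    (hn : σ.arr 10 (J * n + u) = m ∧ v = u ∨ ∃ l : Fin m, σ.arr 10 (J * n + u) = l ∧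
      u = (link l).1 ∧ v = (link l).2 ∧ u ≠ v ∧ slotEdge u v ((g + J : ℕ) : ZMod Γ) ∈ B) :
    Meets W recordEdge σ 70 (fun σ' => σ'.reg 19 = v ∧
      StoresGraph link (if u ≠ v then B.erase (slotEdge u v ((g + J : ℕ) : ZMod Γ)) else B) σ' ∧
      StoresEdge link σ' (b + J) (slotEdge u v ((g + J : ℕ) : ZMod Γ)) ∧
      ∀ a ∈ [4, 5, 6, 8], ∀ x ≠ b + J, σ'.arr a x = σ.arr a x) := by
  have hbasic := hW.basic
  have hmod := Nat.mod_lt (g + J) (NeZero.pos Γ)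
  have hrow := hW.tableRow hJ
  have hrow' := hW.slotRow (g + J)
  have hu := u.2
  have hval : (((g + J : ℕ) : ZMod Γ)).val = (g + J) % Γ := ZMod.val_natCast ..
  have h0 := hG.nodes
  have h1 := hG.links
  have h2 := hG.slots
  rcases hn with ⟨hn, rfl⟩ | ⟨l, hn, rfl, rfl, huv, he⟩
  · refine Program.Safe.meets ?_ (by decide) ?_
    · simp only [recordEdge, Program.Safe, Program.run, Expr.Fits, Expr.eval, Memory.reg_setReg,
        Memory.reg_setCell, Memory.arr_setReg, Memory.arr_setCell, h0, h1, h2, h13, h14, h17, h19,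
        hn, Nat.reduceEqDiff, if_true, if_false, lt_irrefl, eq_self, and_true]
      omega
    · simp only [recordEdge, Program.run, Expr.eval, Memory.reg_setReg,
        Memory.reg_setCell, Memory.arr_setReg, Memory.arr_setCell, h0, h1, h2, h13, h14, h17, h19,
        hn, Nat.reduceEqDiff, if_true, if_false, lt_irrefl, eq_self, true_and]
      refine ⟨?_, ⟨?_, ?_, ?_, ?_⟩, ?_⟩
      · rw [if_neg (by simp)]
        refine hG.agree (R := [20, 21, 22]) (S := [4, 5, 6, 8]) ⟨fun x hx => ?_, fun a ha => ?_⟩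
          (by decide) (by decide)
        · simp only [List.mem_cons, List.not_mem_nil, or_false, not_or] at hx
          simp [Memory.reg_setReg, Memory.reg_setCell, hx]
        · simp only [List.mem_cons, List.not_mem_nil, or_false, not_or] at ha
          simp [Memory.arr_setReg, Memory.arr_setCell, ha]
      · simp [Memory.arr_setCell, Memory.arr_setReg, slotEdge]
      · simp [Memory.arr_setCell, Memory.arr_setReg, slotEdge]
      · simp [Memory.arr_setCell, Memory.arr_setReg, slotEdge, ← hval]
      · left
        simp [Memory.arr_setCell, Memory.arr_setReg, slotEdge]
      · intro a ha x hx
        simp only [List.mem_cons, List.not_mem_nil, or_false] at ha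
        rcases ha with rfl | rfl | rfl | rfl <;> simp [hx]
  · have hl := l.2
    have hhead := hG.head l
    have hv := (link l).2.2
    have hocc := hG.occupied l
    have hoccΓ := occupiedSlots_le B (link l).1 (link l).2
    refine Program.Safe.meets ?_ (by decide) ?_
    · simp only [recordEdge, Program.Safe, Program.run, Expr.Fits, Expr.eval, Memory.reg_setReg,
        Memory.reg_setCell, Memory.arr_setReg, Memory.arr_setCell, h0, h1, h2, h13, h14, h17, h19,
        hn, Nat.reduceEqDiff, if_true, if_false, hl, one_ne_zero, hhead, hocc]
      omega
    · simp only [recordEdge, Program.run, Expr.eval, Memory.reg_setReg,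
        Memory.reg_setCell, Memory.arr_setReg, Memory.arr_setCell, h0, h1, h2, h13, h14, h17, h19,
        hn, Nat.reduceEqDiff, if_true, if_false, hl, one_ne_zero, hhead, true_and]
      refine ⟨?_, ⟨?_, ?_, ?_, ?_⟩, ?_⟩
      · rw [if_pos huv]
        refine hG.occupy hinj he ?_ ?_ ?_ ?_
        · simp [Memory.reg_setCell, Memory.reg_setReg]
        · simp [Memory.arr_setCell, Memory.arr_setReg]
        · simp [Memory.arr_setCell, Memory.arr_setReg, ← hval]
        · simp [Memory.arr_setCell, Memory.arr_setReg]
      · simp [Memory.arr_setCell, Memory.arr_setReg, slotEdge]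
      · simp [Memory.arr_setCell, Memory.arr_setReg, slotEdge]
      · simp [Memory.arr_setCell, Memory.arr_setReg, slotEdge, ← hval]
      · right
        exact ⟨l, by simp [Memory.arr_setCell, Memory.arr_setReg], rfl⟩
      · intro a ha x hx
        simp only [List.mem_cons, List.not_mem_nil, or_false] at ha
        rcases ha with rfl | rfl | rfl | rfl <;> simp [hx]

end

section

variable {n m Γ : ℕ} [NeZero Γ] {link : Fin m → Fin n × Fin n} {A : Finset (Edge (Fin n) Γ)}
  {f : Flow (Fin n)} {W : ℕ} {σ : Memory}

theorem recordPath_meets (hρ : 1 ≤ f.delay) (hW : Wide n m Γ f.delay W) (hinj : Function.Injective link)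
    (hlink : ∀ l, (link l).1 ≠ (link l).2) (hA : IsTECG (Set.range link) A)
    (hG : StoresGraph link A σ) (hI : StoresInput m Γ f σ)
    {P : List (List (Edge (Fin n) Γ))} (hP : StoresRoutes link (f.delay % Γ) f.delay P σ)
    (hPΓ : P.length < Γ) {i : ℕ} (hg : f.packetArrival i + Γ < W)
    (h12 : σ.reg 12 = P.length) (h13 : σ.reg 13 = f.packetArrival i)
    (hT : IsTable link A f i (fun j u => σ.arr 9 (j * n + u)) (fun j u => σ.arr 10 (j * n + u)))
    (hs : σ.arr 9 f.source ≠ 0) :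
    Meets W recordPath σ (f.delay % Γ * 78 + 20) (fun σ' =>
      ∃ p, IsLightestPath f i A p ∧ StoresGraph link (A \ p.toFinset.filter IsComm) σ' ∧
        StoresRoutes link (f.delay % Γ) f.delay (P ++ [p]) σ') := by
  have hbasic := hW.basic
  have hrΓ : f.delay % Γ < Γ := Nat.mod_lt _ (NeZero.pos Γ)
  have hrρ : f.delay % Γ ≤ f.delay := Nat.mod_le _ _
  have hpath := hW.paths
  have hbase : P.length * f.delay + f.delay ≤ W :=
    calc P.length * f.delay + f.delay = (P.length + 1) * f.delay := by ring
      _ ≤ (Γ + 1) * f.delay := Nat.mul_le_mul_right _ (by omega)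
      _ ≤ W := hpath
  set nx : ℕ → ℕ → ℕ := fun j u => σ.arr 10 (j * n + u) with hnx
  set c := route link nx f.source with hc
  set e : ℕ → Edge (Fin n) Γ := routeEdge link nx f.source (f.packetArrival i) with he
  have hD : (fun j u => σ.arr 9 (j * n + u)) 0 f.source ≠ 0 := by simpa using hs
  have hstep : ∀ j, j < f.delay % Γ → _ := fun j hj =>
    (hT.route_succ hA hj (hT.route_ne_zero hA hD (Nat.le_of_lt hj))).2
  refine Meets.mono (T := 6 + ((f.delay % Γ * (70 + 8) + 6) + 8)) (Q := fun σ' => _)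
    (Meets.seq (Q₁ := fun σ' => σ'.reg 19 = f.source ∧ σ'.reg 17 = P.length * f.delay) ?_ ?_)
    (by omega) (fun _ _ h => h)
  · have := f.source.2
    refine Program.Safe.meets ?_ (by decide) ?_
    · simp only [Program.Safe, Program.run, Expr.Fits, Expr.eval, Memory.reg_setReg, hI.source,
        hI.delay, h12, Nat.reduceEqDiff, if_false]
      omega
    · simp [Program.run, Expr.eval, Memory.reg_setReg, hI.source, hI.delay, h12]
  rintro σ₁ ha ⟨h19, h17⟩
  have hG₁ := hG.agree ha (by decide) (by decide)
  have hI₁ := hI.agree ha (by decide)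
  have hP₁ := hP.agree ha (by decide) (by decide)
  refine Meets.seq (Meets.forLoop (fun J σ' => σ'.reg 19 = c J ∧
      StoresGraph link (A \ ((List.range' 0 J).map e).toFinset.filter IsComm) σ' ∧
      (∀ j < J, StoresEdge link σ' (P.length * f.delay + j) (e j)) ∧
      ∀ a ∈ [4, 5, 6, 8], ∀ x < P.length * f.delay, σ'.arr a x = σ₁.arr a x)
    (by decide) (by decide) (by decide) hI₁.depth (by omega) ?_ ?_) ?_
  · refine ⟨h19, ?_, by simp, by simp [Memory.arr_setReg]⟩
    simpa using hG₁.agree ((Memory.Agree.refl [14] [] σ₁).setReg (by simp) 0)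
      (by decide) (by decide)
  · rintro J σ₂ hJ ha₂ h14 ⟨h19₂, hG₂, hE, hf⟩
    obtain ⟨heA, hcase⟩ := hstep J hJ
    have hnJ : σ₂.arr 10 (J * n + c J) = nx J (c J) := by
      rw [ha₂.arr _ (by decide), ha.arr _ (by decide)]
    -- The edges of the route lie in distinct slots, as `ρ % Γ < Γ`. So the edge about to be removed
    -- is still available, and its label is increased correctly.
    have hnot : e J ∉ ((List.range' 0 J).map e).toFinset.filter IsComm := by
      intro h
      obtain ⟨j, hj, h⟩ := List.mem_map.1 (List.mem_toFinset.1 (Finset.mem_filter.1 h).1)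
      rw [List.mem_range'_1] at hj
      have := natCast_add_inj (by omega) (by omega) (congrArg (fun x => x.1.2) h)
      omega
    refine (recordEdge_meets hW hinj hg (b := P.length * f.delay) (v := c (J + 1)) (by omega)
      (by omega) hG₂
      (by rw [ha₂.reg _ (by decide), ha.reg _ (by decide), h13]) h14
      (by rw [ha₂.reg _ (by decide), h17]) h19₂ ?_).mono le_rfl ?_
    · rw [hnJ]
      rcases hcase with ⟨h₁, h₂, -⟩ | ⟨l, h₁, h₂, h₃, -⟩
      · exact .inl ⟨h₁, h₂⟩
      · refine .inr ⟨l, h₁, h₂, h₃, ?_, Finset.mem_sdiff.2 ⟨heA, hnot⟩⟩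
        rw [hc, h₂, h₃]
        exact hlink l
    · rintro σ₃ - ⟨h19₃, hG₃, hE₃, hf₃⟩
      refine ⟨by simpa [Memory.reg_setReg] using h19₃, ?_, fun j hj => ?_, fun a ha' x hx => ?_⟩
      · rw [sdiff_range'_succ]
        exact StoresGraph.agree hG₃ ((Memory.Agree.refl [14] [] σ₃).setReg (by simp) _)
          (by decide) (by decide)
      · rcases Nat.lt_succ_iff_lt_or_eq.1 hj with hj | rfl
        · exact (hE j hj).congr fun a ha' => hf₃ a ha' _ (by omega)
        · exact hE₃.congr fun _ _ => rfl
      · rw [Memory.arr_setReg, hf₃ a ha' x (by omega), hf a ha' x hx]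
  rintro σ₂ ha₂ ⟨-, hG₂, hE, hf⟩
  have hI₂ := hI₁.agree ha₂ (by decide)
  have h12₂ : σ₂.reg 12 = P.length := by rw [ha₂.reg _ (by decide), ha.reg _ (by decide), h12]
  have ha₃ : Memory.Agree [8] [7] σ₂ ((σ₂.setCell 7 P.length (f.delay % Γ)).setReg 8
      (P.length + 1)) := by
    refine ⟨fun x hx => ?_, fun a ha => ?_⟩
    · have : x ≠ 8 := by simpa using hx
      simp [Memory.reg_setReg, Memory.reg_setCell, this]
    · have : a ≠ 7 := by simpa using ha
      simp [Memory.arr_setReg, Memory.arr_setCell, this]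
  refine Program.Safe.meets ?_ (by decide) ?_
  · simp only [Program.Safe, Program.run, Expr.Fits, Expr.eval, Memory.reg_setCell, h12₂,
      hI₂.depth]
    omega
  · simp only [Program.run, Expr.eval, Memory.reg_setCell, h12₂, hI₂.depth]
    refine ⟨_, hT.isLightestPath hρ hlink hA hD, hG₂.agree ha₃ (by decide) (by decide), ?_⟩
    refine ⟨by simp [Memory.reg_setReg], fun k hk => ?_, fun k j hk hj => ?_⟩
    · rw [Memory.arr_setReg, Memory.arr_setCell, if_pos rfl, Function.update_apply]
      rw [List.length_append, List.length_singleton] at hk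
      by_cases hkP : k < P.length
      · rw [if_neg (by omega), List.getElem_append_left hkP, ha₂.arr _ (by decide)]
        exact hP₁.length k hkP
      · obtain rfl : k = P.length := by omega
        simp
    · rw [List.length_append, List.length_singleton] at hk
      by_cases hkP : k < P.length
      · have hlen := (hP₁.length k hkP).2
        simp only [List.getElem_append_left hkP] at hj ⊢
        refine (hP₁.edge k j hkP hj).congr fun a ha' => ?_
        -- The blocks of earlier paths end before the block of the new path begins, so recording it
        -- cannot overwrite them.
        have hlt : k * f.delay + j < P.length * f.delay := by
          have := Nat.mul_le_mul_right f.delay (show k + 1 ≤ P.length from hkP)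
          rw [add_mul] at this
          omega
        rw [ha₃.arr a (by revert ha'; simp; omega), hf a ha' _ hlt]
      · obtain rfl : k = P.length := by omega
        simp only [List.getElem_append_right le_rfl, Nat.sub_self, List.getElem_cons_zero,
          List.length_map, List.length_range'] at hj ⊢
        simp only [List.getElem_map, List.getElem_range', zero_add, one_mul]
        refine (hE j hj).congr fun a ha' => ha₃.arr a (by revert ha'; simp; omega) ▸ rfl

theorem restoreEdge_meets (hW : Wide n m Γ f.delay W) (hinj : Function.Injective link)
    (hA : IsTECG (Set.range link) A) {B : Finset (Edge (Fin n) Γ)} (hAB : A ⊆ B)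
    (hG : StoresGraph link B σ) {b J : ℕ} (hb : b + J ≤ W) (h14 : σ.reg 14 = J)
    (h17 : σ.reg 17 = b) {e : Edge (Fin n) Γ} (he : StoresEdge link σ (b + J) e) :
    Meets W restoreEdge σ 60 (fun σ' => StoresGraph link (insert e B) σ') := by
  have hbasic := hW.basic
  have hval := e.1.2.val_lt
  have hrow := hW.slotRow e.1.2.val
  rw [Nat.mod_eq_of_lt hval] at hrow
  have h1 := hG.links
  have hslot := he.slot
  have hfit : e.1.2.val ≤ W := by omega
  rcases he.number with ⟨h8, h⟩ | ⟨l, h8, h⟩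
  -- Storage edges are never removed, so link number `m` requires no action.
  · have heB : e ∈ B := by rw [h]; exact hAB (hA.1 _ _)
    rw [Finset.insert_eq_of_mem heB]
    refine Program.Safe.meets ?_ (by decide) ?_
    · simp only [restoreEdge, Program.Safe, Program.run, Expr.Fits, Expr.eval, Memory.reg_setReg,
        h14, h17, h8, h1, Nat.reduceEqDiff, if_true, if_false, lt_irrefl, and_true]
      omega
    · simp only [restoreEdge, Program.run, Expr.eval, Memory.reg_setReg,
        h14, h17, h8, h1, Nat.reduceEqDiff, if_true, if_false, lt_irrefl]
      exact hG.agree ((Memory.Agree.refl [20] [] σ).setReg (by simp) _) (by decide) (by decide)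
  · have hl := l.2
    have havail := hG.avail e.1.2 l
    have hocc := hG.occupied l
    have hoccΓ := occupiedSlots_le B (link l).1 (link l).2
    rw [← h] at havail
    -- The availability bit is tested first, so that the label of a link is lowered only when an
    -- edge is really added; this matches the union of sets in the definition of a run.
    by_cases heB : e ∈ B
    · rw [if_pos heB] at havail
      rw [Finset.insert_eq_of_mem heB]
      refine Program.Safe.meets ?_ (by decide) ?_
      · simp only [restoreEdge, Program.Safe, Program.run, Expr.Fits, Expr.eval,
          Memory.reg_setReg, Memory.arr_setReg, h14, h17, h8, h1, hslot, hl, havail,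
          Nat.reduceEqDiff, if_true, if_false, one_ne_zero, and_true]
        omega
      · simp only [restoreEdge, Program.run, Expr.eval,
          Memory.reg_setReg, Memory.arr_setReg, h14, h17, h8, h1, hslot, hl, havail,
          Nat.reduceEqDiff, if_true, if_false, one_ne_zero]
        exact hG.agree (((Memory.Agree.refl [20, 21] [] σ).setReg (by simp) _).setReg (by simp) _)
          (by decide) (by decide)
    · rw [if_neg heB] at havail
      refine Program.Safe.meets ?_ (by decide) ?_
      · simp only [restoreEdge, Program.Safe, Program.run, Expr.Fits, Expr.eval,
          Memory.reg_setReg, Memory.arr_setReg, Memory.reg_setCell, Memory.arr_setCell, h14, h17,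
          h8, h1, hslot, hl, havail, hocc, Nat.reduceEqDiff, if_true, if_false, one_ne_zero]
        omega
      · simp only [restoreEdge, Program.run, Expr.eval,
          Memory.reg_setReg, Memory.arr_setReg, Memory.reg_setCell, Memory.arr_setCell, h14, h17,
          h8, h1, hslot, hl, havail, Nat.reduceEqDiff, if_true, if_false, one_ne_zero]
        have := hG.release hinj (l := l) (t := e.1.2) (by rwa [← h])
          (σ' := (((σ.setReg 20 l).setReg 21 (e.1.2.val * m + l)).setCell 2 (e.1.2.val * m + l)
            1).setCell 3 l (σ.arr 3 l - 1))
          (by simp [Memory.reg_setCell, Memory.reg_setReg])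
          (by simp [Memory.arr_setCell, Memory.arr_setReg])
          (by simp [Memory.arr_setCell, Memory.arr_setReg])
          (by simp [Memory.arr_setCell, Memory.arr_setReg])
        rwa [← h] at this

theorem restorePaths_meets (hW : Wide n m Γ f.delay W) (hinj : Function.Injective link)
    (hA : IsTECG (Set.range link) A) (hG : StoresGraph link A σ) (hI : StoresInput m Γ f σ)
    {P : List (List (Edge (Fin n) Γ))} (hP : StoresRoutes link (f.delay % Γ) f.delay P σ)
    (hPΓ : P.length < Γ) :
    Meets W restorePaths σ (P.length * (f.delay % Γ * 68 + 18) + 10) (fun σ' =>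
      StoresGraph link (A ∪ P.flatten.toFinset) σ' ∧ σ'.reg 8 = 0) := by
  have hbasic := hW.basic
  have hrΓ : f.delay % Γ < Γ := Nat.mod_lt _ (NeZero.pos Γ)
  have hrρ : f.delay % Γ ≤ f.delay := Nat.mod_le _ _
  refine Meets.mono (T := 2 + ((P.length * (4 + (f.delay % Γ * (60 + 8) + 6) + 8) + 6) + 2))
    (Q := fun σ' => _)
    (Meets.seq (Q₁ := fun σ' => σ'.reg 23 = P.length) ?_ ?_)
    (by ring_nf; omega) (fun _ _ h => h)
  · refine Program.Safe.meets ?_ (by decide) ?_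
    · simp only [Program.Safe, Expr.Fits, hP.count]; omega
    · simp [Program.run, Expr.eval, Memory.reg_setReg, hP.count]
  intro σ₁ ha h23
  have hG₁ := hG.agree ha (by decide) (by decide)
  have hI₁ := hI.agree ha (by decide)
  have hP₁ := hP.agree ha (by decide) (by decide)
  refine Meets.seq (Meets.forLoop (fun K σ' =>
      StoresGraph link (A ∪ (P.take K).flatten.toFinset) σ')
    (by decide) (by decide) (by decide) h23 (by omega) ?_ ?_) ?_
  · simpa using hG₁.agree ((Memory.Agree.refl [12] [] σ₁).setReg (by simp) 0)
      (by decide) (by decide)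
  · intro K σ₂ hK ha₂ h12 hG₂
    have hI₂ := hI₁.agree ha₂ (by decide)
    have hP₂ := hP₁.agree ha₂ (by decide) (by decide)
    have hbase : K * f.delay + f.delay ≤ W :=
      calc K * f.delay + f.delay = (K + 1) * f.delay := by ring
        _ ≤ (Γ + 1) * f.delay := Nat.mul_le_mul_right _ (by omega)
        _ ≤ W := hW.paths
    refine Meets.seq (Q₁ := fun σ' => σ'.reg 17 = K * f.delay) ?_ ?_
    · refine Program.Safe.meets ?_ (by decide) ?_
      · simp only [Program.Safe, Expr.Fits, Expr.eval, h12, hI₂.delay]; omega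
      · simp [Program.run, Expr.eval, Memory.reg_setReg, h12, hI₂.delay]
    intro σ₃ ha₃ h17
    have hG₃ := hG₂.agree ha₃ (by decide) (by decide)
    have hI₃ := hI₂.agree ha₃ (by decide)
    have hP₃ := hP₂.agree ha₃ (by decide) (by decide)
    have hlen := (hP₃.length K hK).2
    refine (Meets.forLoop (fun J σ' =>
        StoresGraph link (A ∪ ((P.take K).flatten ++ P[K].take J).toFinset) σ')
      (by decide) (by decide) (by decide) hI₃.depth (by omega) ?_ ?_).mono le_rfl ?_
    · simpa using hG₃.agree ((Memory.Agree.refl [14] [] σ₃).setReg (by simp) 0)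
        (by decide) (by decide)
    · intro J σ₄ hJ ha₄ h14 hG₄
      have hP₄ := hP₃.agree ha₄ (by decide) (by decide)
      have hE := hP₄.edge K J hK (by omega)
      refine (restoreEdge_meets hW hinj hA Finset.subset_union_left hG₄ (by omega) h14
        (by rw [ha₄.reg _ (by decide), h17]) hE).mono le_rfl ?_
      intro σ₅ _ hG₅
      have heq : A ∪ ((P.take K).flatten ++ P[K].take (J + 1)).toFinset =
          insert P[K][J] (A ∪ ((P.take K).flatten ++ P[K].take J).toFinset) := by
        rw [← List.take_append_getElem (by omega)]
        ext x
        simp only [Finset.mem_union, List.mem_toFinset, List.mem_append, List.mem_singleton,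
          Finset.mem_insert]
        tauto
      rw [heq]
      exact hG₅.agree ((Memory.Agree.refl [14] [] σ₅).setReg (by simp) _) (by decide) (by decide)
    · intro σ₄ _ hG₄
      rw [List.take_add_one, List.getElem?_eq_getElem hK, Option.toList_some, List.flatten_append,
        List.flatten_singleton]
      rw [← hlen, List.take_length] at hG₄
      exact hG₄.agree ((Memory.Agree.refl [12] [] σ₄).setReg (by simp) _) (by decide) (by decide)
  · intro σ₂ _ hG₂
    rw [List.take_length] at hG₂
    refine Program.Safe.meets (Nat.zero_le _) (by decide) ⟨?_, ?_⟩
    · exact hG₂.agree ((Memory.Agree.refl [8] [] σ₂).setReg (by simp) _) (by decide) (by decide)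
    · simp [Program.run, Expr.eval, Memory.reg_setReg]

end

/-- Find a path for the packet at hand and record it, or raise the rejection flag. -/
def servePacket : Program :=
  .seq (.assign 13 (.add (.reg 5) (.mul (.reg 12) (.reg 6))))
    (.seq computeWeights (.seq computeTable
      (.ite (.cell 9 (.reg 3)) recordPath (.assign 9 (.const 1)))))

/-- The algorithm HFS-LLF. -/
def hfsLLF : Program :=
  .seq (.seq (.assign 8 (.const 0)) (.seq (.assign 9 (.const 0))
      (.seq (.assign 10 (.mod (.reg 7) (.reg 2))) (.assign 11 (.div (.reg 2) (.reg 6))))))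
    (.seq (.forLoop 12 11 (.ite (.reg 9) .skip servePacket)) (.ite (.reg 9) restorePaths .skip))

/-! ### The complete algorithm -/

section

variable {n m Γ : ℕ} [NeZero Γ] {link : Fin m → Fin n × Fin n} {A : Finset (Edge (Fin n) Γ)}
  {f : Flow (Fin n)} {W : ℕ} {σ : Memory}

theorem servePacket_meets (hρ : 1 ≤ f.delay) (hγ : f.arrival ≤ Γ) (hW : Wide n m Γ f.delay W)
    (hinj : Function.Injective link) (hlink : ∀ l, (link l).1 ≠ (link l).2)
    (hA : IsTECG (Set.range link) A) (hG : StoresGraph link A σ) (hI : StoresInput m Γ f σ)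
    {P : List (List (Edge (Fin n) Γ))} (hP : StoresRoutes link (f.delay % Γ) f.delay P σ)
    (h9 : σ.reg 9 = 0) (hk : P.length < Γ / f.cycle) (h12 : σ.reg 12 = P.length) :
    Meets W servePacket σ (f.delay * (115 * m + 43 * n + 210)) (fun σ' =>
      (σ'.reg 9 = 0 ∧ ∃ p, IsLightestPath f (P.length + 1) A p ∧
        StoresGraph link (A \ p.toFinset.filter IsComm) σ' ∧
        StoresRoutes link (f.delay % Γ) f.delay (P ++ [p]) σ') ∨
      (σ'.reg 9 = 1 ∧ (¬ ∃ p, IsPacketPath f (P.length + 1) A p) ∧ StoresGraph link A σ' ∧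
        StoresRoutes link (f.delay % Γ) f.delay P σ')) := by
  have hbasic := hW.basic
  have hrρ : f.delay % Γ ≤ f.delay := Nat.mod_le _ _
  have hkΓ : P.length < Γ := hk.trans_le (Nat.div_le_self _ _)
  -- With `f.arrival ≤ Γ` the arrival slot is at most `2 * Γ`, and adding an offset below `Γ` stays
  -- within the `3 * Γ` provided for in `Wide.basic`.
  have hkc : P.length * f.cycle ≤ Γ :=
    (Nat.mul_le_mul_right _ hk.le).trans (Nat.div_mul_le_self _ _)
  have harr : f.packetArrival (P.length + 1) = f.arrival + P.length * f.cycle := by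
    simp [Flow.packetArrival]
  have hcyc : f.cycle ≤ Γ := by
    by_contra h
    rw [Nat.div_eq_of_lt (by omega)] at hk
    omega
  refine Meets.mono (T := 6 + ((f.delay % Γ * (19 * m + 22) + 38 * m + 18) +
    ((f.delay % Γ * (28 * n + 58 * m + 45) + 15 * n + 16) + (3 + (f.delay % Γ * 78 + 20)))))
    (Meets.seq (Q₁ := fun σ' => σ'.reg 13 = f.packetArrival (P.length + 1)) ?_ ?_) ?_
    (fun _ _ h => h)
  · refine Program.Safe.meets ?_ (by decide) ?_
    · simp only [Program.Safe, Expr.Fits, Expr.eval, h12, hI.arrival, hI.cycle]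
      omega
    · simp [Program.run, Expr.eval, Memory.reg_setReg, h12, hI.arrival, hI.cycle, harr]
  · intro σ₁ ha h13
    have hG₁ := hG.agree ha (by decide) (by decide)
    have hI₁ := hI.agree ha (by decide)
    refine Meets.seq (computeWeights_meets hW hG₁ hI₁ h13 (by omega)) ?_
    intro σ₂ ha₂ hw
    have hG₂ := hG₁.agree ha₂ (by decide) (by decide)
    have hI₂ := hI₁.agree ha₂ (by decide)
    have h13₂ := (ha₂.reg 13 (by decide)).trans h13
    refine Meets.seq (computeTable_meets hW hG₂ hI₂ (by omega) h13₂ hw) ?_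
    rintro σ₃ ha₃ ⟨hT, hfit⟩
    have hG₃ := hG₂.agree ha₃ (by decide) (by decide)
    have hI₃ := hI₂.agree ha₃ (by decide)
    have hP₃ := ((hP.agree ha (by decide) (by decide)).agree ha₂ (by decide) (by decide)).agree ha₃
      (by decide) (by decide)
    have h12₃ : σ₃.reg 12 = P.length := by
      rw [ha₃.reg _ (by decide), ha₂.reg _ (by decide), ha.reg _ (by decide), h12]
    have h9₃ : σ₃.reg 9 = 0 := by
      rw [ha₃.reg _ (by decide), ha₂.reg _ (by decide), ha.reg _ (by decide), h9]
    have hs := f.source.2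
    have hb : (Expr.cell 9 (.reg 3)).Fits W σ₃ := by
      simp only [Expr.Fits, Expr.eval, hI₃.source]
      exact ⟨by omega, hfit _⟩
    by_cases h0 : σ₃.arr 9 f.source = 0
    · refine Meets.ite_false hb (by simpa only [Expr.eval, hI₃.source] using h0) ?_
      refine Program.Safe.meets (T := f.delay % Γ * 78 + 20) ?_ ?_ ?_
      · simp only [Program.Safe, Expr.Fits]; omega
      · simp only [Program.time, Expr.cost]; omega
      · right
        refine ⟨by simp [Program.run, Expr.eval, Memory.reg_setReg],
          hT.not_exists_path hρ hlink hA (by simpa using h0), ?_, ?_⟩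
        · exact hG₃.agree ((Memory.Agree.refl [9] [] σ₃).setReg (by simp) _) (by decide) (by decide)
        · exact hP₃.agree ((Memory.Agree.refl [9] [] σ₃).setReg (by simp) _) (by decide) (by decide)
    · refine Meets.ite_true hb (by simpa only [Expr.eval, hI₃.source] using h0) ?_
      refine (recordPath_meets hρ hW hinj hlink hA hG₃ hI₃ hP₃ hkΓ (by omega) h12₃
        ((ha₃.reg 13 (by decide)).trans h13₂) hT h0).mono le_rfl ?_
      intro σ₄ ha₄ h
      exact .inl ⟨by rw [ha₄.reg _ (by decide), h9₃], h⟩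
  -- The total is `r * (77 * m + 28 * n + 145) + (38 * m + 15 * n + 63)`; both parts are absorbed
  -- using `r ≤ ρ` and `1 ≤ ρ`.
  · generalize f.delay % Γ = r at hrρ
    have h₁ := Nat.mul_le_mul_right (77 * m + 28 * n + 145) hrρ
    have h₂ := Nat.mul_le_mul_right (38 * m + 15 * n + 63) hρ
    have h₃ : f.delay * (115 * m + 43 * n + 210) = f.delay * (77 * m + 28 * n + 145) +
      f.delay * (38 * m + 15 * n + 63) + 2 * f.delay := by ring
    rw [h₃]
    refine le_trans (le_of_eq ?_) (Nat.le_add_right_of_le (Nat.add_le_add h₁ h₂))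
    ring

/-- The state of the main loop after the `k`-th round. -/
def LoopState (link : Fin m → Fin n × Fin n) (f : Flow (Fin n)) (A₀ : Finset (Edge (Fin n) Γ))
    (k : ℕ) (σ : Memory) : Prop :=
  ∃ (A : Finset (Edge (Fin n) Γ)) (P : List (List (Edge (Fin n) Γ))),
    IsTECG (Set.range link) A ∧ StoresGraph link A σ ∧
    StoresRoutes link (f.delay % Γ) f.delay P σ ∧
    ((σ.reg 9 = 0 ∧ P.length = k ∧
        ∀ q A' P', Run f (k + 1) A P q A' P' → Run f 1 A₀ [] (q + k) A' P') ∨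
      (σ.reg 9 = 1 ∧ P.length < Γ / f.cycle ∧
        Run f 1 A₀ [] (P.length + 1) (A ∪ P.flatten.toFinset) []))

theorem LoopState.agree {A₀ : Finset (Edge (Fin n) Γ)} {k : ℕ} {σ' : Memory} {R : List ℕ}
    (h : LoopState link f A₀ k σ) (ha : Memory.Agree R [] σ σ')
    (hR : ∀ x ∈ [0, 1, 2, 8, 9], x ∉ R) : LoopState link f A₀ k σ' := by
  obtain ⟨A, P, hA, hG, hP, h⟩ := h
  refine ⟨A, P, hA, hG.agree ha (fun x hx => hR x (by revert hx; simp; tauto)) (by simp),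
    hP.agree ha (hR _ (by simp)) (by simp), ?_⟩
  rwa [ha.reg _ (hR _ (by simp))]

/-- A run is built from its last round backwards, whereas the loop executes forwards. The invariant
therefore carries a continuation: any run completing the present state yields a run from the start.
After a rejection the completed run is already known, and the remaining rounds only test the flag.
-/
theorem mainLoop_meets (hρ : 1 ≤ f.delay) (hγ : f.arrival ≤ Γ) (hW : Wide n m Γ f.delay W)
    (hinj : Function.Injective link) (hlink : ∀ l, (link l).1 ≠ (link l).2)
    (hA : IsTECG (Set.range link) A) (hG : StoresGraph link A σ) (hI : StoresInput m Γ f σ)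
    (h8 : σ.reg 8 = 0) (h9 : σ.reg 9 = 0) :
    Meets W (.forLoop 12 11 (.ite (.reg 9) .skip servePacket)) σ
      (Γ / f.cycle * (f.delay * (115 * m + 43 * n + 210) + 10) + 6)
      (LoopState link f A (Γ / f.cycle)) := by
  have hbasic := hW.basic
  have hΓ := NeZero.pos Γ
  have hNΓ : Γ / f.cycle ≤ Γ := Nat.div_le_self _ _
  have hpos : 0 < f.delay * (115 * m + 43 * n + 210) := Nat.mul_pos hρ (by omega)
  refine Meets.forLoop (B := f.delay * (115 * m + 43 * n + 210) + 2) _ (by decide) (by decide)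
    (by decide) hI.packets (by omega) ?_ ?_
  · refine LoopState.agree (σ := σ) ⟨A, [], hA, hG, ⟨h8, by simp, by simp⟩,
      .inl ⟨h9, rfl, fun q A' P' h => h⟩⟩ ((Memory.Agree.refl [12] [] σ).setReg (by simp) _)
      (by decide)
  rintro k σ₁ hk ha h12 ⟨A₁, P, hA₁, hG₁, hP, ⟨h9, rfl, hrun⟩ | ⟨h9, hlen, hrun⟩⟩
  · refine (Meets.ite_false (b := .reg 9) (c₁ := .skip) (by simp [Expr.Fits, h9]) h9
      (servePacket_meets hρ hγ hW hinj hlink hA₁ hG₁ (hI.agree ha (by decide)) hP h9 hk h12)).mono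
      (by simp only [Expr.cost]; omega) ?_
    rintro σ₂ - h
    refine LoopState.agree (σ := σ₂) ?_ ((Memory.Agree.refl [12] [] σ₂).setReg (by simp) _)
      (by decide)
    rcases h with ⟨h9₂, p, hp, hG₂, hP₂⟩ | ⟨h9₂, hp, hG₂, hP₂⟩
    · refine ⟨_, _, hA₁.sdiff _, hG₂, hP₂, .inl ⟨h9₂, by simp, fun q A' P' h => ?_⟩⟩
      rw [← hp.1.accept_eq hρ hA₁] at h
      have := hrun _ _ _ (.accept hk hp h)
      rwa [add_right_comm, add_assoc] at this
    · refine ⟨_, _, hA₁, hG₂, hP₂, .inr ⟨h9₂, hk, ?_⟩⟩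
      have := hrun _ _ _ (.reject hk hp)
      rwa [reject_eq, add_comm] at this
  · refine (Meets.ite_true (b := .reg 9) (c₂ := servePacket) (by simp only [Expr.Fits, h9]; omega)
      (by simp [Expr.eval, h9]) (Meets.skip (Q := fun σ' => σ' = σ₁) rfl)).mono
      (by simp only [Expr.cost]; omega) ?_
    rintro σ₂ - rfl
    exact LoopState.agree ⟨A₁, P, hA₁, hG₁, hP, .inr ⟨h9, hlen, hrun⟩⟩
      ((Memory.Agree.refl [12] [] σ₂).setReg (by simp) _) (by decide)

theorem hfsLLF_meets (hρ : 1 ≤ f.delay) (hγ : f.arrival ≤ Γ) (hcycle : 1 ≤ f.cycle)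
    (hdvd : f.cycle ∣ Γ) (hW : Wide n m Γ f.delay W)
    (hinj : Function.Injective link) (hlink : ∀ l, (link l).1 ≠ (link l).2)
    (hA : IsTECG (Set.range link) A) (hG : StoresGraph link A σ) (hf : StoresFlow f σ) :
    Meets W hfsLLF σ (Γ / f.cycle * f.delay * (115 * m + 43 * n + 346)) (fun σ' =>
      ∃ (q : ℕ) (A' : Finset (Edge (Fin n) Γ)) (P : List (List (Edge (Fin n) Γ))),
        Run f 1 A [] q A' P ∧ StoresGraph link A' σ' ∧ StoresPaths f.delay P σ' ∧
        q ≤ Γ / f.cycle ∧ (P ≠ [] → q = Γ / f.cycle ∧ P.length = Γ / f.cycle)) := by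
  have hbasic := hW.basic
  have hΓ := NeZero.pos Γ
  have hrρ : f.delay % Γ ≤ f.delay := Nat.mod_le _ _
  have hNΓ : Γ / f.cycle ≤ Γ := Nat.div_le_self _ _
  have hN : 1 ≤ Γ / f.cycle := Nat.div_pos (Nat.le_of_dvd hΓ hdvd) hcycle
  have hcycleΓ := Nat.le_of_dvd hΓ hdvd
  refine Meets.mono (T := 12 + ((Γ / f.cycle * (f.delay * (115 * m + 43 * n + 210) + 10) + 6) +
    (2 + (Γ / f.cycle * (f.delay % Γ * 68 + 18) + 10)))) (Q := fun σ' => _)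
    (Meets.seq (Q₁ := fun σ' => StoresGraph link A σ' ∧ StoresInput m Γ f σ' ∧ σ'.reg 8 = 0 ∧
      σ'.reg 9 = 0) ?_ ?_) ?_ (fun _ _ h => h)
  · refine Program.Safe.meets ?_ (by decide) ?_
    · simp only [Program.Safe, Program.run, Expr.Fits, Memory.reg_setReg, Nat.reduceEqDiff,
        if_false, hf.delay, hf.cycle, hG.slots]
      omega
    · simp only [Program.run, Expr.eval, Memory.reg_setReg, Nat.reduceEqDiff, if_false, hf.delay,
        hf.cycle, hG.slots]
      refine ⟨?_, ⟨⟨?_, ?_, ?_, ?_, ?_⟩, ?_, ?_, ?_, ?_, ?_⟩, ?_, ?_⟩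
      · exact hG.agree (((((Memory.Agree.refl [8, 9, 10, 11] [] σ).setReg (by simp) _).setReg
          (by simp) _).setReg (by simp) _).setReg (by simp) _) (by decide) (by decide)
      all_goals simp [Memory.reg_setReg, hf.source, hf.target, hf.arrival, hf.cycle, hf.delay,
        hG.nodes, hG.links, hG.slots]
  · rintro σ₁ - ⟨hG₁, hI₁, h8, h9⟩
    refine Meets.seq (mainLoop_meets hρ hγ hW hinj hlink hA hG₁ hI₁ h8 h9) ?_
    rintro σ₂ ha₂ ⟨A₂, P, hA₂, hG₂, hP, ⟨h9, hlen, hrun⟩ | ⟨h9, hlen, hrun⟩⟩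
    · refine (Meets.ite_false (b := .reg 9) (c₁ := restorePaths) (by simp [Expr.Fits, h9]) h9
        (Meets.skip (Q := fun σ' => σ' = σ₂) rfl)).mono
        (by simp only [Expr.cost]; omega) ?_
      rintro σ₃ - rfl
      have h := hrun 0 A₂ P (.finish (by omega))
      rw [zero_add] at h
      exact ⟨_, _, _, h, hG₂, hP.storesPaths hrρ, le_rfl, fun _ => ⟨rfl, hlen⟩⟩
    · refine (Meets.ite_true (b := .reg 9) (c₂ := .skip) (by simp only [Expr.Fits, h9]; omega)
        (by simp [Expr.eval, h9])
        (restorePaths_meets hW hinj hA₂ hG₂ (hI₁.agree ha₂ (by decide)) hP (by omega))).mono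
        ?_ ?_
      · have := Nat.mul_le_mul_right (f.delay % Γ * 68 + 18) hlen.le
        simp only [Expr.cost]; omega
      · rintro σ₃ - ⟨hG₃, h8₃⟩
        exact ⟨_, _, _, hrun, hG₃, ⟨h8₃, by simp, by simp, by simp, by simp⟩, hlen, by simp⟩
  -- Initialization, loop overhead and a possible restoration are charged to the summand `136 * (Γ /
  -- λ) * ρ`, using `1 ≤ Γ / λ` and `1 ≤ ρ`.
  · have h₁ : Γ / f.cycle * 1 ≤ Γ / f.cycle * f.delay := Nat.mul_le_mul_left _ hρ
    have h₂ : Γ / f.cycle * (f.delay % Γ) ≤ Γ / f.cycle * f.delay := Nat.mul_le_mul_left _ hrρ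
    have h₃ : ∀ x, Γ / f.cycle * (f.delay * x + 10) = Γ / f.cycle * f.delay * x +
      Γ / f.cycle * 10 := fun x => by ring
    have h₄ : Γ / f.cycle * (f.delay % Γ * 68 + 18) = Γ / f.cycle * (f.delay % Γ) * 68 +
      Γ / f.cycle * 18 := by ring
    have h₅ : Γ / f.cycle * f.delay * (115 * m + 43 * n + 346) =
      Γ / f.cycle * f.delay * (115 * m + 43 * n + 210) + Γ / f.cycle * f.delay * 136 := by ring
    rw [h₃, h₄, h₅]
    omega

/-- The largest numbers are the distances, at most about `2 * S ^ 3` for `S = n + m + Γ + ρ`. Since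
`S ≥ 4`, one more factor `S` absorbs the constants, whence the exponent 4. -/
theorem wide_pow (hn : 2 ≤ n) {ρ : ℕ} (hρ : 1 ≤ ρ) :
    Wide n m Γ ρ ((n + m + Γ + ρ) ^ 4) := by
  have hΓ := NeZero.pos Γ
  obtain ⟨S, hS⟩ : ∃ S, S = n + m + Γ + ρ := ⟨_, rfl⟩
  rw [← hS]
  have h₁ : S * 4 ≤ S * S := Nat.mul_le_mul_left _ (by omega)
  have h₂ : S * S * 1 ≤ S * S * (S * S) := Nat.mul_le_mul_left _ (by nlinarith)
  have h₃ : S * (S * S) * 4 ≤ S * (S * S) * S := Nat.mul_le_mul_left _ (by omega)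
  have h₄ : S ^ 4 = S * S * (S * S) := by ring
  have h₅ : S * (S * S) * S = S * S * (S * S) := by ring
  have h₆ : (Γ + 1) * (2 * (Γ * ρ)) ≤ S * (2 * (S * S)) :=
    Nat.mul_le_mul (by omega) (Nat.mul_le_mul_left _ (Nat.mul_le_mul (by omega) (by omega)))
  have h₇ : S * (2 * (S * S)) = S * (S * S) * 2 := by ring
  have h₈ : 1 ≤ S * (S * S) := by
    have : 0 < S := by omega
    exact Nat.mul_pos this (Nat.mul_pos this this)
  refine ⟨?_, ?_, ?_, ?_, ?_⟩
  · omega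
  · have : (Γ + 1) * m ≤ S * S := Nat.mul_le_mul (by omega) (by omega)
    omega
  · have : (Γ + 1) * n ≤ S * S := Nat.mul_le_mul (by omega) (by omega)
    omega
  · have : (Γ + 1) * ρ ≤ S * S := Nat.mul_le_mul (by omega) (by omega)
    omega
  · omega

end

/-- From `log n ≥ log 2 > 1 / 2` one gets `500 * n * log n ≥ 250 * n`, and `207 * n ≥ 414` covers
the constant 346. -/
theorem linear_le_log {n : ℕ} (hn : 2 ≤ n) (m : ℕ) :
    ((115 * m + 43 * n + 346 : ℕ) : ℝ) ≤ 500 * ((m : ℝ) + (n : ℝ) * Real.log (n : ℝ)) := by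
  have hn' : (2 : ℝ) ≤ n := by exact_mod_cast hn
  have hlog : (1 / 2 : ℝ) ≤ Real.log n := by
    have h := Real.log_le_log (by norm_num) hn'
    have := Real.log_two_gt_d9
    linarith
  have hm : (0 : ℝ) ≤ m := Nat.cast_nonneg m
  push_cast
  nlinarith [mul_le_mul_of_nonneg_left hlog (by linarith : (0 : ℝ) ≤ n)]

end HFS

theorem mainTheorem12 :
    -- one program, one time constant and one word-size exponent for all inputs
    (∃ (prog : HFS.Program) (C : ℝ) (k : ℕ),
      ∀ (n m Γ : ℕ) [NeZero Γ] (link : Fin m → Fin n × Fin n) (A : Finset (HFS.Edge (Fin n) Γ))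
        (f : HFS.Flow (Fin n)) (σ : HFS.Memory),
        2 ≤ n →
        Function.Injective link →
        (∀ l, (link l).1 ≠ (link l).2) →
        HFS.IsTECG (Set.range link) A →
        1 ≤ f.arrival → f.arrival ≤ Γ → 1 ≤ f.cycle → f.cycle ∣ Γ → 1 ≤ f.delay →
        HFS.StoresGraph link A σ →
        HFS.StoresFlow f σ →
        ∃ (σ' : HFS.Memory) (T q : ℕ) (A' : Finset (HFS.Edge (Fin n) Γ))
          (P : List (List (HFS.Edge (Fin n) Γ))),
          HFS.Exec ((n + m + Γ + f.delay) ^ k) prog σ σ' T ∧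
          HFS.Run f 1 A [] q A' P ∧
          HFS.StoresGraph link A' σ' ∧
          HFS.StoresPaths f.delay P σ' ∧
          q ≤ Γ / f.cycle ∧
          (P ≠ [] → q = Γ / f.cycle ∧ P.length = Γ / f.cycle) ∧
          (T : ℝ) ≤ C * (((Γ / f.cycle : ℕ) : ℝ) * (f.delay : ℝ) *
            ((m : ℝ) + (n : ℝ) * Real.log (n : ℝ)))) ∧
    -- every shortest-path computation is confined to the slots of the lifespan of the packet
    (∀ (n Γ : ℕ) [NeZero Γ] (L : Set (Fin n × Fin n)) (A : Finset (HFS.Edge (Fin n) Γ))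
        (f : HFS.Flow (Fin n)) (i : ℕ) (p : List (HFS.Edge (Fin n) Γ)),
        HFS.IsTECG L A → 1 ≤ f.delay → HFS.IsPacketPath f i A p →
        p.length ≤ f.delay ∧ ∀ e ∈ p, e.1.2 ∈ f.lifespan Γ i) := by
  refine ⟨⟨HFS.hfsLLF, 500, 4, ?_⟩, ?_⟩
  · intro n m Γ _ link A f σ hn hinj hlink hA _ hγ hcycle hdvd hρ hG hf
    obtain ⟨σ', T, he, hT, q, A', P, hrun, hG', hP, hq, hPq⟩ :=
      HFS.hfsLLF_meets hρ hγ hcycle hdvd (HFS.wide_pow hn hρ) hinj hlink hA hG hf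
    refine ⟨σ', T, q, A', P, he, hrun, hG', hP, hq, hPq, ?_⟩
    calc (T : ℝ) ≤ ((Γ / f.cycle * f.delay * (115 * m + 43 * n + 346) : ℕ) : ℝ) :=
          Nat.cast_le.2 hT
      _ = ((Γ / f.cycle : ℕ) : ℝ) * (f.delay : ℝ) * ((115 * m + 43 * n + 346 : ℕ) : ℝ) := by
          rw [Nat.cast_mul, Nat.cast_mul]
      _ ≤ ((Γ / f.cycle : ℕ) : ℝ) * (f.delay : ℝ) *
          (500 * ((m : ℝ) + (n : ℝ) * Real.log (n : ℝ))) :=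
          mul_le_mul_of_nonneg_left (HFS.linear_le_log hn m) (by positivity)
      _ = _ := by ring
  · intro n Γ _ L A f i p hA hρ hp
    exact hp.confined hρ hA
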